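/- Let $\mathcal{A}=\operatorname{Av}(4231,35142,42513,351624)$ be the class of permutations that contain none of these four patterns. A permutation is *simple* if the only nonempty intervals that it maps to intervals are the singletons and its entire domain; only simple permutations of length at least $4$ are considered. Let $L$ be the language of all words $w$ over $\{a,b,c,d\}$ of length at least $4$ such that $w$ begins and ends with $dd$, contains none of the factors $aa$, $bb$, $cc$, $da$, does not begin with $dda$, and does not end with $cdd$. A word $w=w_1\cdots w_n$ encodes a permutation of length $n$ as follows. Put $t_i=i/(n+1)$, let $j$ be the number of letters $d$ among $w_1,\dots,w_{i-1}$, and associate with $w_i$ the point $P_i$ given by: - if $w_i=d$: $P_i=(4m-3,\,4m-1)$ if $j=2m$, and $P_i=(4m+2,\,4m-2)$ if $j=2m+1$; - if $j=2m+2$ (an $N$-shaped block): $P_i=(4m+t_i,\,4m+t_i)$, $(4m+2-t_i,\,4m+t_i)$, $(4m+2+t_i,\,4m+t_i)$ for $w_i=a,b,c$ respectively; - if $j=2m+3$ (an $S$-shaped block): $P_i=(4m+3+t_i,\,4m+1+t_i)$, $(4m+3+t_i,\,4m+3-t_i)$, $(4m+3+t_i,\,4m+3+t_i)$ for $w_i=a,b,c$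 respectively (words in $L$ begin with $dd$, so a letter other than $d$ always has $j\ge 2$). The encoded permutation is the pattern formed by the heights of $P_1,\dots,P_n$ read from left to right. Then: 1. $L$ is a regular language. 2. The encoding is a length-preserving bijection between $L$ and the set of simple permutations $\pi\in\mathcal{A}$ of length at least $4$ with $\pi(2)\neq 1$. 3. In commuting variables $a,b,c,d$ the generating function of $L$ (equivalently, of these permutations, each point contributing the letter that encodes it) is $$\frac{d^4(1+b)}{1-2abc-ac-ab-bd-bc-bcd-cd-d}.$$ 4. The generating function by length of the simple permutations $\pi\in\mathcal{A}$ of length at least $4$ with $\pi(2)\neq 1$ is $\dfrac{x^4}{(1-3x)(1+x)}$. 5. The generating function by length of all simple permutations in $\mathcal{A}$ of length at least $4$ is twice this, namely $\dfrac{2x^4}{(1-3x)(1+x)}$. -/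

import Mathlib

namespace HullPerm

/-- `π` contains the pattern with one-line notation `σ 0, σ 1, …, σ (k-1)`. -/
def ContainsPattern {k n : ℕ} (σ : Fin k → ℕ) (π : Equiv.Perm (Fin n)) : Prop :=
  ∃ f : Fin k ↪o Fin n, ∀ i j : Fin k, σ i < σ j ↔ π (f i) < π (f j)

/-- Membership of the class `Av(4231, 35142, 42513, 351624)`. -/
def InClassA {n : ℕ} (π : Equiv.Perm (Fin n)) : Prop :=
  ¬ ContainsPattern ![4, 2, 3, 1] π ∧
  ¬ ContainsPattern ![3, 5, 1, 4, 2] π ∧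
  ¬ ContainsPattern ![4, 2, 5, 1, 3] π ∧
  ¬ ContainsPattern ![3, 5, 1, 6, 2, 4] π

/-- A permutation is simple if the only intervals of positions which it maps onto intervals of
values are the singletons (and the empty set) and the whole domain. -/
def IsSimple {n : ℕ} (π : Equiv.Perm (Fin n)) : Prop :=
  ∀ I : Set (Fin n), I.OrdConnected → (π '' I).OrdConnected → I.Subsingleton ∨ I = Set.univ

/-- The simple permutations of the class that have length at least four. -/
def IsSimpleInA {n : ℕ} (π : Equiv.Perm (Fin n)) : Prop :=
  4 ≤ n ∧ IsSimple π ∧ InClassA π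

/-- `π(2) ≠ 1` in the usual one-based numbering of positions and values. -/
def SecondNeOne {n : ℕ} (π : Equiv.Perm (Fin n)) : Prop :=
  ∀ i : Fin n, (i : ℕ) = 1 → (π i : ℕ) ≠ 0

/-- The four-letter alphabet. -/
inductive Letter where
  | a | b | c | d
  deriving DecidableEq

open Letter in
/-- The language of codes, given by local conditions: the words of length at least four that begin
and end with `dd`, contain none of the factors `aa`, `bb`, `cc`, `da`, do not begin with `dda` and
do not end with `cdd`. -/
def codeLanguage : Language Letter :=
  {w | 4 ≤ w.length ∧ [d, d] <+: w ∧ [d, d] <:+ w ∧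
    ¬ [a, a] <:+: w ∧ ¬ [b, b] <:+: w ∧ ¬ [c, c] <:+: w ∧
    ¬ [d, d, a] <+: w ∧ ¬ [c, d, d] <:+ w ∧ ¬ [d, a] <:+: w}

/-- The point of the plane encoded by a letter which is preceded in its word by `j` letters `d`.
The parameter `t ∈ (0, 1)` measures progress along the line segments of the crenellation.

The `j`-th isolated point (counting from `0`) lies above the crenellation, at
`(4m - 3, 4m - 1)`, if `j = 2m`, and below it, at `(4m + 2, 4m - 2)`, if `j = 2m + 1`.

The letters `a`, `b`, `c` preceded by `j = 2m + 2` letters `d` make up the `m`-th `N`-shaped block,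
in `[4m, 4m + 3] × [4m, 4m + 1]`, which is read from bottom to top. Those preceded by `j = 2m + 3`
letters `d` make up the `m`-th `S`-shaped block, in `[4m + 3, 4m + 4] × [4m + 1, 4m + 4]`, which is
read from left to right. In both types of block the segments of the letters `a` and `c` are
increasing and the segment of the letter `b` is decreasing. -/
def pointOf (t : ℚ) (j : ℕ) : Letter → ℚ × ℚ
  | Letter.d =>
      let m : ℚ := ((j / 2 : ℕ) : ℚ)
      if Even j then (4 * m - 3, 4 * m - 1) else (4 * m + 2, 4 * m - 2)
  | Letter.a =>
      let m : ℚ := ((j / 2 : ℕ) : ℚ) - 1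
      if Even j then (4 * m + t, 4 * m + t) else (4 * m + 3 + t, 4 * m + 1 + t)
  | Letter.b =>
      let m : ℚ := ((j / 2 : ℕ) : ℚ) - 1
      if Even j then (4 * m + 2 - t, 4 * m + t) else (4 * m + 3 + t, 4 * m + 3 - t)
  | Letter.c =>
      let m : ℚ := ((j / 2 : ℕ) : ℚ) - 1
      if Even j then (4 * m + 2 + t, 4 * m + t) else (4 * m + 3 + t, 4 * m + 3 + t)

/-- The point encoded by the `i`-th letter of the word `w`. -/
def wordPoint (w : List Letter) (i : Fin w.length) : ℚ × ℚ :=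
  pointOf (((i : ℕ) + 1 : ℚ) / ((w.length : ℚ) + 1)) ((w.take i).count Letter.d) (w.get i)

/-- The word `w` encodes `π`: the points of `w`, sorted from left to right, have the relative
vertical order of `π(1), …, π(n)`. The bijection `e` sends each letter to the position in `π` of the
point which it encodes. -/
def Encodes {n : ℕ} (w : List Letter) (π : Equiv.Perm (Fin n)) : Prop :=
  ∃ e : Fin w.length ≃ Fin n,
    (∀ i j, (wordPoint w i).1 < (wordPoint w j).1 ↔ e i < e j) ∧
    (∀ i j, (wordPoint w i).2 < (wordPoint w j).2 ↔ π (e i) < π (e j))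

/-- The exponent vector of a word: how often each letter occurs in it. -/
noncomputable def letterCount (w : List Letter) : Letter →₀ ℕ :=
  Multiset.toFinsupp (w : Multiset Letter)

/-- Permutations of arbitrary finite length which are simple, of length at least four, belong to the
class, and satisfy `π(2) ≠ 1`. -/
def HalfSimples : Type :=
  {p : Σ n : ℕ, Equiv.Perm (Fin n) // IsSimpleInA p.2 ∧ SecondNeOne p.2}

/-- The generating function, by length, of the simple permutations of the class with
`π(2) ≠ 1`. -/
noncomputable def halfGF : PowerSeries ℤ :=
  PowerSeries.mk fun n =>
    (Nat.card {π : Equiv.Perm (Fin n) // IsSimpleInA π ∧ SecondNeOne π} : ℤ)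

/-- The generating function, by length, of all simple permutations of the class, of length at least
four. -/
noncomputable def simpleGF : PowerSeries ℤ :=
  PowerSeries.mk fun n => (Nat.card {π : Equiv.Perm (Fin n) // IsSimpleInA π} : ℤ)

/-- The generating function of the code language in commuting variables, one for each letter. -/
noncomputable def languageGF : MvPowerSeries Letter ℤ :=
  fun m => (Nat.card {w : List Letter // w ∈ codeLanguage ∧ letterCount w = m} : ℤ)

/-- Given an encoding of the permutations by words, their generating function in commuting
variables, in which a point contributes the letter that encodes it. -/
noncomputable def refinedGF (enc : HalfSimples ≃ {w : List Letter // w ∈ codeLanguage}) :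
    MvPowerSeries Letter ℤ :=
  fun m => (Nat.card {p : HalfSimples // letterCount (enc p).1 = m} : ℤ)

/-- The denominator `1 - 2abc - ac - ab - bd - bc - bcd - cd - d`. -/
noncomputable def refinedDenominator : MvPowerSeries Letter ℤ :=
  let a : MvPowerSeries Letter ℤ := MvPowerSeries.X Letter.a
  let b : MvPowerSeries Letter ℤ := MvPowerSeries.X Letter.b
  let c : MvPowerSeries Letter ℤ := MvPowerSeries.X Letter.c
  let d : MvPowerSeries Letter ℤ := MvPowerSeries.X Letter.d
  1 - 2 * a * b * c - a * c - a * b - b * d - b * c - b * c * d - c * d - d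

/-- The numerator `d⁴(1 + b)`. -/
noncomputable def refinedNumerator : MvPowerSeries Letter ℤ :=
  MvPowerSeries.X Letter.d ^ 4 * (1 + MvPowerSeries.X Letter.b)

end HullPerm

namespace HullPerm

/-! The geometric encoding is replaced by a purely order-theoretic one, a way of peeling a point
set. At every stage a pivot lies below all remaining points, and the points to its left form a
nonempty slot. If the slot has at least two points, pattern avoidance and simplicity force the
lowest point to be the leftmost of the slot (`a`), the rightmost of the slot (`b`) or the leftmost
beyond the pivot (`c`); see `Config.lowest_mem`, where all four patterns enter. If the slot is a
single point, that point becomes the next pivot (`d`) and the axes are interchanged, which is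
harmless because each of the four patterns is an involution.

One ambiguity remains. If the slot is a single point and the lowest point is also the leftmost
beyond the pivot, then `cd` and `da` describe the same two points. The factor `da` is therefore
forbidden. The other conditions express simplicity: a repeated `a`, `b` or `c`, or a final `cdd`,
gives an interval of two points.

The crenellation realizes every word that begins with `d` by points of the right shape
(`fullShape_labelled`), and a shape determines all comparisons (`FullShape.agree`). So encoding a
permutation means labelling its points with the prescribed shape (`encodes_iff`). The bijection then
has four ingredients: shapes avoid the patterns (`FullShape.avoids`), admissible shapes are simple
(`FullShape.simple`), the labelling is unique (`FullShape.unique`), and every simple permutation of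
the class with `π(2) ≠ 1` has one (`exists_fullShape`).

Since the language is given by local conditions, it has finitely many left quotients, and splitting
words by their first letter gives a linear system for the generating function
(`wordGF_codeLanguage`). Inversion preserves the simple permutations of the class and exchanges
those with `π(2) ≠ 1` and those with `π(2) = 1`, whence the factor two. -/

variable {ι κ α β : Type*} [LinearOrder α] [LinearOrder β]

/-! ### Shapes of labelled point sequences -/

/-- The shape of a labelled sequence of points with coordinates `x` and `y`, relative to a pivot `e`
which lies below all of them. The points to the left of the pivot form the current slot; the
letters `a`, `b`, `c` announce the lowest remaining point, which is the leftmost point of the slot,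
the rightmost point of the slot, or the leftmost point beyond the pivot. The letter `d` announces
the last point of the slot, which becomes the next pivot, with the axes interchanged. -/
def Shape (x y : ι → α) (e : ι) : List (Letter × ι) → Prop
  | [] => True
  | (.a, p) :: l => x p < x e ∧ (∀ q ∈ l, x p < x q.2 ∧ y p < y q.2) ∧ Shape x y e l
  | (.b, p) :: l =>
      x p < x e ∧ (∀ q ∈ l, y p < y q.2 ∧ (x q.2 < x e → x q.2 < x p)) ∧ Shape x y e l
  | (.c, p) :: l =>
      x e < x p ∧ (∀ q ∈ l, y p < y q.2 ∧ (x e < x q.2 → x p < x q.2)) ∧ Shape x y e l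
  | (.d, p) :: l => x p < x e ∧ (∀ q ∈ l, x e < x q.2) ∧ Shape y x p l

/-- The words that may follow a pivot: they end with `dd` (or are the word `d`), do not end with
`cdd`, and contain none of the factors `aa`, `bb`, `cc`, `da`. -/
def Admissible : List Letter → Prop
  | [] => False
  | [s] => s = .d
  | s :: t :: u => Admissible (t :: u) ∧ ((s = t → s = .d) ∧ (s = .d → t ≠ .a)) ∧
      (u = [] → s = .d) ∧ (s = .c → t :: u ≠ [.d, .d])

/-- The shape of all points of a permutation: the first point is the leftmost one, and serves as a
pivot for the others. -/
def FullShape (x y : ι → α) : List (Letter × ι) → Prop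
  | (.d, p) :: l => (∀ q ∈ l, x p < x q.2) ∧ Shape y x p l
  | _ => False

theorem Shape.lt_or_gt {x y : ι → α} {e : ι} {l : List (Letter × ι)} (h : Shape x y e l) :
    ∀ q ∈ l, x q.2 < x e ∨ x e < x q.2 := by
  induction l with
  | nil => simp
  | cons s l ih =>
    obtain ⟨s, p⟩ := s
    cases s <;> simp only [Shape] at h <;> grind

/-- Each letter fixes the place of its point relative to all later points, once it is known which of
these lie in the slot. The first conjunct carries that information through the induction. -/
theorem Shape.agree {x y : ι → α} {x' y' : ι → β} {e : ι} {l : List (Letter × ι)}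
    (h : Shape x y e l) (h' : Shape x' y' e l) :
    (∀ q ∈ l, x q.2 < x e ↔ x' q.2 < x' e) ∧
    ∀ p ∈ l, ∀ q ∈ l, (x p.2 < x q.2 ↔ x' p.2 < x' q.2) ∧ (y p.2 < y q.2 ↔ y' p.2 < y' q.2) := by
  induction l generalizing x y x' y' e with
  | nil => simp
  | cons s l ih =>
    obtain ⟨s, r⟩ := s
    have g : ∀ q ∈ l, x q.2 < x e ∨ x e < x q.2 := fun q hq => h.lt_or_gt q (by simp [hq])
    have g' : ∀ q ∈ l, x' q.2 < x' e ∨ x' e < x' q.2 := fun q hq => h'.lt_or_gt q (by simp [hq])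
    cases s
    case d =>
      simp only [Shape] at h h'
      have k := h.2.2.lt_or_gt
      have k' := h'.2.2.lt_or_gt
      obtain ⟨i1, i2⟩ := ih h.2.2 h'.2.2
      constructor
      · grind
      · simp only [List.mem_cons, forall_eq_or_imp]
        grind
    all_goals
      simp only [Shape] at h h'
      obtain ⟨i1, i2⟩ := ih h.2.2 h'.2.2
      constructor
      · grind
      · simp only [List.mem_cons, forall_eq_or_imp]
        grind

theorem Shape.ne {x y : ι → α} {e : ι} {l : List (Letter × ι)} (h : Shape x y e l)
    (hl : (l.map Prod.snd).Nodup) :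
    ∀ p ∈ l, ∀ q ∈ l, p.2 ≠ q.2 → x p.2 ≠ x q.2 ∧ y p.2 ≠ y q.2 := by
  induction l generalizing x y e with
  | nil => simp
  | cons s l ih =>
    obtain ⟨s, r⟩ := s
    have g : ∀ q ∈ l, x q.2 < x e ∨ x e < x q.2 := fun q hq => h.lt_or_gt q (by simp [hq])
    simp only [List.map_cons, List.nodup_cons] at hl
    cases s
    case d =>
      simp only [Shape] at h
      have k := h.2.2.lt_or_gt
      have i := ih h.2.2 hl.2
      simp only [List.mem_cons, forall_eq_or_imp]
      grind
    all_goals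
      simp only [Shape] at h
      have i := ih h.2.2 hl.2
      simp only [List.mem_cons, forall_eq_or_imp]
      grind

theorem Shape.map_iff {x y : κ → α} (f : ι → κ) {e : ι} {l : List (Letter × ι)} :
    Shape x y (f e) (l.map (Prod.map id f)) ↔ Shape (fun i => x (f i)) (fun i => y (f i)) e l := by
  induction l generalizing x y e with
  | nil => simp [Shape]
  | cons s l ih =>
    obtain ⟨s, r⟩ := s
    cases s <;> simp only [List.map_cons, Shape, List.forall_mem_map, Prod.map, id, ih]

theorem Shape.congr {x y : ι → α} {x' y' : ι → β} (hx : ∀ i j, x i < x j ↔ x' i < x' j)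
    (hy : ∀ i j, y i < y j ↔ y' i < y' j) {e : ι} {l : List (Letter × ι)} :
    Shape x y e l ↔ Shape x' y' e l := by
  induction l generalizing x y x' y' e with
  | nil => simp [Shape]
  | cons s l ih =>
    obtain ⟨s, r⟩ := s
    cases s <;> simp only [Shape, ih hx hy, ih hy hx, hx, hy]

theorem FullShape.map_iff {x y : κ → α} (f : ι → κ) {l : List (Letter × ι)} :
    FullShape x y (l.map (Prod.map id f)) ↔
      FullShape (fun i => x (f i)) (fun i => y (f i)) l := by
  rcases l with _ | ⟨⟨s, p⟩, l⟩
  · simp [FullShape]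
  · cases s <;>
      simp only [List.map_cons, FullShape, List.forall_mem_map, Prod.map, id, Shape.map_iff]

theorem FullShape.congr {x y : ι → α} {x' y' : ι → β} (hx : ∀ i j, x i < x j ↔ x' i < x' j)
    (hy : ∀ i j, y i < y j ↔ y' i < y' j) {l : List (Letter × ι)} :
    FullShape x y l ↔ FullShape x' y' l := by
  rcases l with _ | ⟨⟨s, p⟩, l⟩
  · simp [FullShape]
  · cases s <;> simp [FullShape, Shape.congr hy hx, hx]

theorem FullShape.agree {x y : ι → α} {x' y' : ι → β} {l : List (Letter × ι)}
    (h : FullShape x y l) (h' : FullShape x' y' l) :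
    ∀ p ∈ l, ∀ q ∈ l, (x p.2 < x q.2 ↔ x' p.2 < x' q.2) ∧ (y p.2 < y q.2 ↔ y' p.2 < y' q.2) := by
  rcases l with _ | ⟨⟨s, p⟩, l⟩
  · simp
  · cases s <;> simp only [FullShape] at h h'
    have k := h.2.lt_or_gt
    have k' := h'.2.lt_or_gt
    obtain ⟨i1, i2⟩ := h.2.agree h'.2
    simp only [List.mem_cons, forall_eq_or_imp]
    grind

theorem FullShape.ne {x y : ι → α} {l : List (Letter × ι)} (h : FullShape x y l)
    (hl : (l.map Prod.snd).Nodup) :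
    ∀ p ∈ l, ∀ q ∈ l, p.2 ≠ q.2 → x p.2 ≠ x q.2 ∧ y p.2 ≠ y q.2 := by
  rcases l with _ | ⟨⟨s, p⟩, l⟩
  · simp
  · cases s <;> simp only [FullShape] at h
    simp only [List.map_cons, List.nodup_cons] at hl
    have k := h.2.lt_or_gt
    have i := h.2.ne hl.2
    simp only [List.mem_cons, forall_eq_or_imp]
    grind

theorem Admissible.tail {s : Letter} {u : List Letter} (h : Admissible (s :: u)) (hu : u ≠ []) :
    Admissible u := by
  rcases u with _ | ⟨t, u⟩
  · simp at hu
  · exact h.1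

theorem Admissible.ne_nil {s : Letter} {u : List Letter} (h : Admissible (s :: u)) (hs : s ≠ .d) :
    u ≠ [] := by
  rintro rfl
  exact hs h

/-- Only `c` places a point beyond the pivot, and an admissible word cannot stop after a `c`. -/
theorem Shape.exists_lt {x y : ι → α} {e : ι} {l : List (Letter × ι)} (h : Shape x y e l)
    (hl : Admissible (l.map Prod.fst)) : ∃ q ∈ l, x q.2 < x e := by
  induction l with
  | nil => simp [Admissible] at hl
  | cons s l ih =>
    obtain ⟨s, r⟩ := s
    cases s
    case c =>
      simp only [Shape] at h
      obtain ⟨q, hq, hlt⟩ := ih h.2.2 (hl.tail (hl.ne_nil (by simp)))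
      exact ⟨q, by simp [hq], hlt⟩
    all_goals exact ⟨_, List.mem_cons_self, h.1⟩

/-! ### Points on the crenellation -/

/-- The points lie on the crenellation, in a frame in which the current block begins at `(A, B)`,
with parameters greater than `t` and less than `1`. -/
def OnCrenellation (u v : ι → ℚ) (A B t : ℚ) : List (Letter × ι) → Prop
  | [] => True
  | (.a, p) :: l => ∃ s, t < s ∧ s < 1 ∧ u p = A + s ∧ v p = B + s ∧ OnCrenellation u v A B s l
  | (.b, p) :: l => ∃ s, t < s ∧ s < 1 ∧ u p = A + 2 - s ∧ v p = B + s ∧ OnCrenellation u v A B s l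
  | (.c, p) :: l => ∃ s, t < s ∧ s < 1 ∧ u p = A + 2 + s ∧ v p = B + s ∧ OnCrenellation u v A B s l
  | (.d, p) :: l => ∃ s, t < s ∧ s < 1 ∧ u p = A + 1 ∧ v p = B + 3 ∧
      OnCrenellation v u (B + 1) (A + 3) s l

theorem OnCrenellation.bounds {u v : ι → ℚ} {A B t : ℚ} {l : List (Letter × ι)}
    (h : OnCrenellation u v A B t l) (ht : 0 ≤ t) :
    ∀ q ∈ l, B + t < v q.2 ∧
      (A + t < u q.2 ∧ u q.2 < A + 2 - t ∨ A + 2 + t < u q.2) := by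
  induction l generalizing u v A B t with
  | nil => simp
  | cons s l ih =>
    obtain ⟨s, p⟩ := s
    simp only [List.mem_cons, forall_eq_or_imp]
    cases s <;> obtain ⟨s, h1, h2, h3, h4, h5⟩ := h <;> have i := ih h5 (ht.trans h1.le)
    · exact ⟨⟨by linarith, .inl ⟨by linarith, by linarith⟩⟩, fun q hq => ⟨by linarith [(i q hq).1],
        (i q hq).2.imp (fun h => ⟨by linarith, by linarith⟩) fun h => by linarith⟩⟩
    · exact ⟨⟨by linarith, .inl ⟨by linarith, by linarith⟩⟩, fun q hq => ⟨by linarith [(i q hq).1],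
        (i q hq).2.imp (fun h => ⟨by linarith, by linarith⟩) fun h => by linarith⟩⟩
    · exact ⟨⟨by linarith, .inr (by linarith)⟩, fun q hq => ⟨by linarith [(i q hq).1],
        (i q hq).2.imp (fun h => ⟨by linarith, by linarith⟩) fun h => by linarith⟩⟩
    · refine ⟨⟨by linarith, .inl ⟨by linarith, by linarith⟩⟩, fun q hq => ⟨?_, .inr ?_⟩⟩
      · rcases (i q hq).2 with h | h <;> linarith
      · linarith [(i q hq).1]

/-- The abscissa `A + 2` separates the segments of `a` and `b` from that of `c`. As the parameter
grows, all three segments rise; those of `a` and `c` run to the right and that of `b` to the left,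
so an earlier point is extreme at its own place. -/
theorem OnCrenellation.shape {u v : ι → ℚ} {A B t : ℚ} {l : List (Letter × ι)} {e : ι}
    (h : OnCrenellation u v A B t l) (ht : 0 ≤ t) (he : u e = A + 2) : Shape u v e l := by
  induction l generalizing u v A B t e with
  | nil => trivial
  | cons s l ih =>
    obtain ⟨s, p⟩ := s
    cases s <;> obtain ⟨s, h1, h2, h3, h4, h5⟩ := h <;> have i := h5.bounds (ht.trans h1.le)
    · refine ⟨by linarith, fun q hq => ⟨?_, by linarith [(i q hq).1]⟩, ih h5 (ht.trans h1.le) he⟩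
      rcases (i q hq).2 with h | h <;> linarith
    · refine ⟨by linarith, fun q hq => ⟨by linarith [(i q hq).1], fun k => ?_⟩,
        ih h5 (ht.trans h1.le) he⟩
      rcases (i q hq).2 with h | h <;> linarith
    · refine ⟨by linarith, fun q hq => ⟨by linarith [(i q hq).1], fun k => ?_⟩,
        ih h5 (ht.trans h1.le) he⟩
      rcases (i q hq).2 with h | h <;> linarith
    · exact ⟨by linarith, fun q hq => by linarith [(i q hq).1],
        ih h5 (ht.trans h1.le) (by linarith)⟩

/-- The positions of a word, labelled by its letters. -/
def labelled (w : List Letter) : List (Letter × Fin w.length) :=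
  (List.finRange w.length).map fun i => (w.get i, i)

theorem labelled_fst (w : List Letter) : (labelled w).map Prod.fst = w := by
  simp [labelled, Function.comp_def]

theorem labelled_snd (w : List Letter) : (labelled w).map Prod.snd = List.finRange w.length := by
  simp [labelled, Function.comp_def]

/-- Passing a `d` turns the frame `(A, B)` into `(B + 1, A + 3)` with the axes interchanged, so two
letters `d` shift the frame by `(4, 4)`. The parity of the number of letters `d` already read
decides which axis comes first. -/
theorem onCrenellation_drop (w : List Letter) (k : ℕ) (hk : k ≤ w.length) :
    (∀ m, (w.take k).count .d = 2 * m → OnCrenellation (fun i => (wordPoint w i).1)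
      (fun i => (wordPoint w i).2) (4 * m - 4) (4 * m - 4) (k / (w.length + 1))
      ((labelled w).drop k)) ∧
    (∀ m, (w.take k).count .d = 2 * m + 1 → OnCrenellation (fun i => (wordPoint w i).2)
      (fun i => (wordPoint w i).1) (4 * m - 3) (4 * m - 1) (k / (w.length + 1))
      ((labelled w).drop k)) := by
  induction hk using Nat.decreasingInduction with
  | self =>
    rw [List.drop_eq_nil_of_le (by simp [labelled])]
    exact ⟨fun _ _ => trivial, fun _ _ => trivial⟩
  | of_succ k hk ih =>
    have h0 : (labelled w).drop k = (w[k], ⟨k, hk⟩) :: (labelled w).drop (k + 1) := by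
      rw [List.drop_eq_getElem_cons (by simpa [labelled] using hk)]
      simp [labelled]
    have hw : (0 : ℚ) < w.length + 1 := by positivity
    have h1 : (k : ℚ) / (w.length + 1) < ((k : ℕ) + 1 : ℚ) / ((w.length : ℚ) + 1) := by
      gcongr; linarith
    have h2 : ((k : ℕ) + 1 : ℚ) / ((w.length : ℚ) + 1) < 1 := by
      rw [div_lt_one hw]
      have : (k : ℚ) < w.length := by exact_mod_cast hk
      linarith
    have h3 : (w.take (k + 1)).count .d =
        (w.take k).count .d + if w[k] = .d then 1 else 0 := by
      rw [List.take_succ_eq_append_getElem hk, List.count_append, List.count_singleton]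
      simp
    have hp : wordPoint w ⟨k, hk⟩ =
      pointOf (((k : ℕ) + 1 : ℚ) / ((w.length : ℚ) + 1)) ((w.take k).count .d) w[k] := rfl
    have hodd (m : ℕ) : (2 * m + 1) / 2 = m := by omega
    have hne (m : ℕ) : ¬ Even (2 * m + 1) := by simp
    rw [h0]
    push_cast at ih
    constructor
    · intro m hm
      rw [hm] at hp h3
      cases hs : w[k] <;> rw [hs] at hp h3 <;> simp [pointOf] at hp h3 <;>
        refine ⟨_, h1, h2, ?_⟩
      · exact ⟨by simp only [hp]; ring, by simp only [hp]; ring, ih.1 m h3⟩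
      · exact ⟨by simp only [hp]; ring, by simp only [hp]; ring, ih.1 m h3⟩
      · exact ⟨by simp only [hp]; ring, by simp only [hp]; ring, ih.1 m h3⟩
      · refine ⟨by simp only [hp]; ring, by simp only [hp]; ring, ?_⟩
        convert ih.2 m h3 using 1 <;> ring
    · intro m hm
      rw [hm] at hp h3
      cases hs : w[k] <;> rw [hs] at hp h3 <;> simp [pointOf, hodd, hne] at hp h3 <;>
        refine ⟨_, h1, h2, ?_⟩
      · exact ⟨by simp only [hp]; ring, by simp only [hp]; ring, ih.2 m h3⟩
      · exact ⟨by simp only [hp]; ring, by simp only [hp]; ring, ih.2 m h3⟩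
      · exact ⟨by simp only [hp]; ring, by simp only [hp]; ring, ih.2 m h3⟩
      · refine ⟨by simp only [hp]; ring, by simp only [hp]; ring, ?_⟩
        convert ih.1 (m + 1) (by omega) using 1 <;> push_cast <;> ring

theorem fullShape_labelled {w : List Letter} (hw : [.d] <+: w) :
    FullShape (fun i => (wordPoint w i).1) (fun i => (wordPoint w i).2) (labelled w) := by
  -- Before any letter is read, the frame is at `(-4, -4)` with parameter `0`; the first `d` lies at
  -- `(-3, -1)` in it.
  have h := (onCrenellation_drop w 0 (by simp)).1 0 (by simp)
  obtain ⟨u, rfl⟩ := hw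
  have h0 : labelled ([.d] ++ u) = (.d, ⟨0, by simp⟩) :: (labelled ([.d] ++ u)).drop 1 := by
    have := List.drop_eq_getElem_cons (l := labelled ([Letter.d] ++ u)) (i := 0)
      (by simp [labelled])
    rw [List.drop_zero] at this
    rw [this]
    simp [labelled]
  rw [h0] at h ⊢
  simp only [List.drop_zero] at h
  obtain ⟨s, h1, h2, h3, h4, h5⟩ := h
  have hs : 0 ≤ s := le_trans (by positivity) h1.le
  refine ⟨fun q hq => ?_, h5.shape hs ?_⟩
  · have := (h5.bounds hs q hq).1
    linarith
  · linarith

/-! ### Encodings as labellings -/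

/-- A labelling of all positions of a permutation by the letters of a word. -/
def IsLabelling {n : ℕ} (w : List Letter) (π : Equiv.Perm (Fin n))
    (l : List (Letter × Fin n)) : Prop :=
  l.map Prod.fst = w ∧ (l.map Prod.snd).Nodup ∧ (∀ i, ∃ q ∈ l, q.2 = i) ∧
    FullShape (fun i => i) (fun i => π i) l

/-- A labelling and the crenellation give two realizations of the same labelled word, and by
`FullShape.agree` these are order isomorphic. Admissibility plays no role here; a leading `d`
suffices. -/
theorem encodes_iff {n : ℕ} {w : List Letter} (hw : [.d] <+: w) {π : Equiv.Perm (Fin n)} :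
    Encodes w π ↔ ∃ l, IsLabelling w π l := by
  constructor
  · rintro ⟨e, hx, hy⟩
    refine ⟨(labelled w).map (Prod.map id e), ?_, ?_, ?_, ?_⟩
    · simpa [Function.comp_def] using labelled_fst w
    · have : ((labelled w).map (Prod.map id e)).map Prod.snd =
          ((labelled w).map Prod.snd).map e := by simp
      rw [this, labelled_snd]
      exact (List.nodup_finRange _).map e.injective
    · intro i
      exact ⟨(w.get (e.symm i), i), by simpa [labelled] using ⟨_, rfl, by simp⟩, rfl⟩
    · rw [FullShape.map_iff]
      exact (FullShape.congr hx hy).1 (fullShape_labelled hw)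
  · rintro ⟨l, rfl, h2, h3, h4⟩
    have hlen : (l.map Prod.fst).length = l.length := by simp
    let f : Fin (l.map Prod.fst).length → Fin n := fun i => (l.get (i.cast hlen)).2
    have hf : Function.Bijective f := by
      constructor
      · intro i j hij
        rw [List.nodup_iff_injective_get] at h2
        have := @h2 (i.cast (by simp)) (j.cast (by simp)) (by simpa [f] using hij)
        simpa [Fin.ext_iff] using this
      · intro i
        obtain ⟨q, hq, rfl⟩ := h3 i
        obtain ⟨k, rfl⟩ := List.get_of_mem hq
        exact ⟨k.cast hlen.symm, rfl⟩
    have hl : (labelled (l.map Prod.fst)).map (Prod.map id f) = l := by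
      apply List.ext_get
      · simp [labelled]
      · intro i hi hi'
        simp [labelled, f]
    rw [← hl, FullShape.map_iff] at h4
    have key := (fullShape_labelled hw).agree h4
    have hmem : ∀ i, ((l.map Prod.fst).get i, i) ∈ labelled (l.map Prod.fst) := by
      simp [labelled]
    exact ⟨Equiv.ofBijective f hf, fun i j => (key _ (hmem i) _ (hmem j)).1,
      fun i j => (key _ (hmem i) _ (hmem j)).2⟩

theorem exists_equiv_lt_iff {n : ℕ} {x : Fin n → α} (hx : Function.Injective x) :
    ∃ e : Equiv.Perm (Fin n), ∀ i j, x i < x j ↔ e i < e j := by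
  refine ⟨(Tuple.sort x).symm, fun i j => ?_⟩
  have h : StrictMono (x ∘ Tuple.sort x) :=
    (Tuple.monotone_sort x).strictMono_of_injective (hx.comp (Tuple.sort x).injective)
  rw [← h.lt_iff_lt]
  simp

theorem exists_encodes {w : List Letter} (hw : [.d] <+: w) :
    ∃ π : Equiv.Perm (Fin w.length), Encodes w π := by
  have h := (fullShape_labelled hw).ne (by rw [labelled_snd]; exact List.nodup_finRange _)
  have hmem : ∀ i, (w.get i, i) ∈ labelled w := by simp [labelled]
  have h' (i j) (hij : i ≠ j) := h _ (hmem i) _ (hmem j) hij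
  obtain ⟨e, he⟩ := exists_equiv_lt_iff (x := fun i => (wordPoint w i).1)
    (fun i j hij => by_contra fun hne => (h' i j hne).1 hij)
  obtain ⟨f, hf⟩ := exists_equiv_lt_iff (x := fun i => (wordPoint w i).2)
    (fun i j hij => by_contra fun hne => (h' i j hne).2 hij)
  exact ⟨e.symm.trans f, e, he, by simpa using hf⟩

theorem Encodes.length_eq {n : ℕ} {w : List Letter} {π : Equiv.Perm (Fin n)} (h : Encodes w π) :
    w.length = n := by
  obtain ⟨e, -⟩ := h
  simpa using Fintype.card_congr e

/-- Two encodings differ by order automorphisms of `Fin n`, horizontally and vertically, and these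
are trivial. -/
theorem Encodes.perm_unique {n : ℕ} {w : List Letter} {π π' : Equiv.Perm (Fin n)}
    (h : Encodes w π) (h' : Encodes w π') : π = π' := by
  obtain ⟨e, hx, hy⟩ := h
  obtain ⟨e', hx', hy'⟩ := h'
  have key (g : Equiv.Perm (Fin n)) (hg : ∀ i j, i < j ↔ g i < g j) (i : Fin n) : g i = i := by
    let o : Fin n ≃o Fin n := ⟨g, by intro a b; rw [← not_lt, ← not_lt, ← hg]⟩
    exact congrArg (fun f : Fin n ≃o Fin n => f i) (Subsingleton.elim o (OrderIso.refl _))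
  have h1 (i) : e i = e' i := by
    have := key (e.symm.trans e') (by intro i j; simp [← hx', hx]) (e i)
    simpa using this.symm
  ext1 i
  obtain ⟨i, rfl⟩ := e.surjective i
  have := key ((e.trans π).symm.trans (e'.trans π')) (by intro i j; simp [← hy', hy]) (π (e i))
  simp only [Equiv.trans_apply, Equiv.symm_trans_apply, Equiv.symm_apply_apply] at this
  rw [← this, h1]

/-! ### Avoidance of the four patterns -/

/-- The set of points with coordinates `x` and `y` avoids the four patterns. -/
structure Avoids (x y : ι → α) (S : Set ι) : Prop where
  h4231 : ∀ p ∈ S, ∀ q ∈ S, ∀ r ∈ S, ∀ s ∈ S, x p < x q → x q < x r → x r < x s →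
    y s < y q → y q < y r → y r < y p → False
  h35142 : ∀ p ∈ S, ∀ q ∈ S, ∀ r ∈ S, ∀ s ∈ S, ∀ t ∈ S,
    x p < x q → x q < x r → x r < x s → x s < x t →
    y r < y t → y t < y p → y p < y s → y s < y q → False
  h42513 : ∀ p ∈ S, ∀ q ∈ S, ∀ r ∈ S, ∀ s ∈ S, ∀ t ∈ S,
    x p < x q → x q < x r → x r < x s → x s < x t →
    y s < y q → y q < y t → y t < y p → y p < y r → False
  h351624 : ∀ p ∈ S, ∀ q ∈ S, ∀ r ∈ S, ∀ s ∈ S, ∀ t ∈ S, ∀ u ∈ S,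
    x p < x q → x q < x r → x r < x s → x s < x t → x t < x u →
    y r < y t → y t < y p → y p < y u → y u < y q → y q < y s → False

/-- Each of the four patterns is an involution. -/
theorem Avoids.swap {x y : ι → α} {S : Set ι} (h : Avoids x y S) : Avoids y x S where
  h4231 p hp q hq r hr s hs h1 h2 h3 h4 h5 h6 :=
    h.h4231 s hs q hq r hr p hp h4 h5 h6 h1 h2 h3
  h35142 p hp q hq r hr s hs t ht h1 h2 h3 h4 h5 h6 h7 h8 :=
    h.h35142 r hr t ht p hp s hs q hq h5 h6 h7 h8 h1 h2 h3 h4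
  h42513 p hp q hq r hr s hs t ht h1 h2 h3 h4 h5 h6 h7 h8 :=
    h.h42513 s hs q hq t ht p hp r hr h5 h6 h7 h8 h1 h2 h3 h4
  h351624 p hp q hq r hr s hs t ht u hu h1 h2 h3 h4 h5 h6 h7 h8 h9 h10 :=
    h.h351624 r hr t ht p hp u hu q hq s hs h6 h7 h8 h9 h10 h1 h2 h3 h4 h5

theorem Avoids.mono {x y : ι → α} {S T : Set ι} (h : Avoids x y T) (hST : S ⊆ T) :
    Avoids x y S where
  h4231 p hp q hq r hr s hs :=
    h.h4231 p (hST hp) q (hST hq) r (hST hr) s (hST hs)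
  h35142 p hp q hq r hr s hs t ht :=
    h.h35142 p (hST hp) q (hST hq) r (hST hr) s (hST hs) t (hST ht)
  h42513 p hp q hq r hr s hs t ht :=
    h.h42513 p (hST hp) q (hST hq) r (hST hr) s (hST hs) t (hST ht)
  h351624 p hp q hq r hr s hs t ht u hu :=
    h.h351624 p (hST hp) q (hST hq) r (hST hr) s (hST hs) t (hST ht) u (hST hu)

/-- The points avoid what is left of the four patterns after deletion of their lowest point, if the
place of the deleted point is at the abscissa of `e`. -/
structure SplitAvoids (x y : ι → α) (e : ι) (S : Set ι) : Prop where
  h4231 : ∀ p ∈ S, ∀ q ∈ S, ∀ r ∈ S, x p < x q → x q < x r → x r < x e →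
    y q < y r → y r < y p → False
  h35142 : ∀ p ∈ S, ∀ q ∈ S, ∀ s ∈ S, ∀ t ∈ S,
    x p < x q → x q < x e → x e < x s → x s < x t →
    y t < y p → y p < y s → y s < y q → False
  h42513 : ∀ p ∈ S, ∀ q ∈ S, ∀ r ∈ S, ∀ t ∈ S,
    x p < x q → x q < x r → x r < x e → x e < x t →
    y q < y t → y t < y p → y p < y r → False
  h351624 : ∀ p ∈ S, ∀ q ∈ S, ∀ s ∈ S, ∀ t ∈ S, ∀ u ∈ S,
    x p < x q → x q < x e → x e < x s → x s < x t → x t < x u →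
    y t < y p → y p < y u → y u < y q → y q < y s → False

/-- Being lowest, the new point can only play the entry `1` of a pattern. -/
theorem Avoids.insert {x y : ι → α} {e : ι} {S : Set ι} (h : Avoids x y S)
    (h' : SplitAvoids x y e S) (he : ∀ p ∈ S, y e < y p) : Avoids x y (insert e S) where
  h4231 p hp q hq r hr s hs h1 h2 h3 h4 h5 h6 := by
    have hp' : p ∈ S := hp.resolve_left (by rintro rfl; rcases hs with rfl | hs <;> grind)
    have hq' : q ∈ S := hq.resolve_left (by rintro rfl; rcases hs with rfl | hs <;> grind)
    have hr' : r ∈ S := hr.resolve_left (by rintro rfl; rcases hs with rfl | hs <;> grind)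
    rcases hs with rfl | hs
    · exact h'.h4231 p hp' q hq' r hr' h1 h2 h3 h5 h6
    · exact h.h4231 p hp' q hq' r hr' s hs h1 h2 h3 h4 h5 h6
  h35142 p hp q hq r hr s hs t ht h1 h2 h3 h4 h5 h6 h7 h8 := by
    have hp' : p ∈ S := hp.resolve_left (by rintro rfl; rcases hr with rfl | hr <;> grind)
    have hq' : q ∈ S := hq.resolve_left (by rintro rfl; rcases hr with rfl | hr <;> grind)
    have hs' : s ∈ S := hs.resolve_left (by rintro rfl; rcases hr with rfl | hr <;> grind)
    have ht' : t ∈ S := ht.resolve_left (by rintro rfl; rcases hr with rfl | hr <;> grind)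
    rcases hr with rfl | hr
    · exact h'.h35142 p hp' q hq' s hs' t ht' h1 h2 h3 h4 h6 h7 h8
    · exact h.h35142 p hp' q hq' r hr s hs' t ht' h1 h2 h3 h4 h5 h6 h7 h8
  h42513 p hp q hq r hr s hs t ht h1 h2 h3 h4 h5 h6 h7 h8 := by
    have hp' : p ∈ S := hp.resolve_left (by rintro rfl; rcases hs with rfl | hs <;> grind)
    have hq' : q ∈ S := hq.resolve_left (by rintro rfl; rcases hs with rfl | hs <;> grind)
    have hr' : r ∈ S := hr.resolve_left (by rintro rfl; rcases hs with rfl | hs <;> grind)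
    have ht' : t ∈ S := ht.resolve_left (by rintro rfl; rcases hs with rfl | hs <;> grind)
    rcases hs with rfl | hs
    · exact h'.h42513 p hp' q hq' r hr' t ht' h1 h2 h3 h4 h6 h7 h8
    · exact h.h42513 p hp' q hq' r hr' s hs t ht' h1 h2 h3 h4 h5 h6 h7 h8
  h351624 p hp q hq r hr s hs t ht u hu h1 h2 h3 h4 h5 h6 h7 h8 h9 h10 := by
    have hp' : p ∈ S := hp.resolve_left (by rintro rfl; rcases hr with rfl | hr <;> grind)
    have hq' : q ∈ S := hq.resolve_left (by rintro rfl; rcases hr with rfl | hr <;> grind)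
    have hs' : s ∈ S := hs.resolve_left (by rintro rfl; rcases hr with rfl | hr <;> grind)
    have ht' : t ∈ S := ht.resolve_left (by rintro rfl; rcases hr with rfl | hr <;> grind)
    have hu' : u ∈ S := hu.resolve_left (by rintro rfl; rcases hr with rfl | hr <;> grind)
    rcases hr with rfl | hr
    · exact h'.h351624 p hp' q hq' s hs' t ht' u hu' h1 h2 h3 h4 h5 h7 h8 h9 h10
    · exact h.h351624 p hp' q hq' r hr s hs' t ht' u hu' h1 h2 h3 h4 h5 h6 h7 h8 h9 h10

/-- The new point could only play the entry `2`. In `4231` and `42513` the `2` stands strictly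
between two other entries to the left of the `1`; in `35142` and `351624` another entry separates it
from the `1` on the right. None of the places announced by `a`, `b`, `c` allows this. -/
theorem SplitAvoids.insert {x y : ι → α} {e f : ι} {S : Set ι} (h : SplitAvoids x y e S)
    (hf : ∀ p ∈ S, y f < y p)
    (hx : (∀ p ∈ S, x p < x e → x f < x p) ∧ x f < x e ∨ (∀ p ∈ S, x p < x e → x p < x f) ∧ x f < x e
      ∨ (∀ p ∈ S, x e < x p → x f < x p) ∧ x e < x f) :
    SplitAvoids x y e (insert f S) where
  h4231 p hp q hq r hr h1 h2 h3 h4 h5 := by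
    have hp' : p ∈ S := hp.resolve_left (by rintro rfl; rcases hq with rfl | hq <;> grind)
    have hr' : r ∈ S := hr.resolve_left (by rintro rfl; rcases hq with rfl | hq <;> grind)
    rcases hq with rfl | hq
    · have := hx.imp (fun h => h.1 p hp' (by order)) (Or.imp (fun h => h.1 r hr' h3) (·.2))
      rcases this with h | h | h <;> order
    · exact h.h4231 p hp' q hq r hr' h1 h2 h3 h4 h5
  h35142 p hp q hq s hs t ht h1 h2 h3 h4 h5 h6 h7 := by
    have hp' : p ∈ S := hp.resolve_left (by rintro rfl; rcases ht with rfl | ht <;> grind)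
    have hq' : q ∈ S := hq.resolve_left (by rintro rfl; rcases ht with rfl | ht <;> grind)
    have hs' : s ∈ S := hs.resolve_left (by rintro rfl; rcases ht with rfl | ht <;> grind)
    rcases ht with rfl | ht
    · have := hx.imp (fun h => h.2) (Or.imp (fun h => h.2) (fun h => h.1 s hs' h3))
      rcases this with h | h | h <;> order
    · exact h.h35142 p hp' q hq' s hs' t ht h1 h2 h3 h4 h5 h6 h7
  h42513 p hp q hq r hr t ht h1 h2 h3 h4 h5 h6 h7 := by
    have hp' : p ∈ S := hp.resolve_left (by rintro rfl; rcases hq with rfl | hq <;> grind)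
    have hr' : r ∈ S := hr.resolve_left (by rintro rfl; rcases hq with rfl | hq <;> grind)
    have ht' : t ∈ S := ht.resolve_left (by rintro rfl; rcases hq with rfl | hq <;> grind)
    rcases hq with rfl | hq
    · have := hx.imp (fun h => h.1 p hp' (by order)) (Or.imp (fun h => h.1 r hr' h3) (·.2))
      rcases this with h | h | h <;> order
    · exact h.h42513 p hp' q hq r hr' t ht' h1 h2 h3 h4 h5 h6 h7
  h351624 p hp q hq s hs t ht u hu h1 h2 h3 h4 h5 h6 h7 h8 h9 := by
    have hp' : p ∈ S := hp.resolve_left (by rintro rfl; rcases ht with rfl | ht <;> grind)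
    have hq' : q ∈ S := hq.resolve_left (by rintro rfl; rcases ht with rfl | ht <;> grind)
    have hs' : s ∈ S := hs.resolve_left (by rintro rfl; rcases ht with rfl | ht <;> grind)
    have hu' : u ∈ S := hu.resolve_left (by rintro rfl; rcases ht with rfl | ht <;> grind)
    rcases ht with rfl | ht
    · have := hx.imp (fun h => h.2) (Or.imp (fun h => h.2) (fun h => h.1 s hs' h3))
      rcases this with h | h | h <;> order
    · exact h.h351624 p hp' q hq' s hs' t ht u hu' h1 h2 h3 h4 h5 h6 h7 h8 h9

/-- The set of points of a labelled sequence. -/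
def points (l : List (Letter × ι)) : Set ι := {i | ∃ q ∈ l, q.2 = i}

theorem points_cons (s : Letter × ι) (l : List (Letter × ι)) :
    points (s :: l) = insert s.2 (points l) := by
  ext i
  simp [points, eq_comm]

@[simp] theorem points_nil : points ([] : List (Letter × ι)) = ∅ := by
  simp [points]

theorem forall_mem_points {l : List (Letter × ι)} {P : ι → Prop} :
    (∀ i ∈ points l, P i) ↔ ∀ q ∈ l, P q.2 := by
  constructor
  · exact fun h q hq => h _ ⟨q, hq, rfl⟩
  · rintro h _ ⟨q, hq, rfl⟩
    exact h q hq

theorem SplitAvoids.of_forall_lt {x y : ι → α} {e : ι} {S : Set ι}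
    (h : ∀ p ∈ S, x e < x p) : SplitAvoids x y e S := by
  constructor <;> grind

/-- In each pattern at least two entries precede the `1`, whereas only one point can lie to the left
of the cut. -/
theorem SplitAvoids.insert_of_forall_gt {x y : ι → α} {e f : ι} {S : Set ι}
    (h : ∀ p ∈ S, x e < x p) : SplitAvoids x y e (Insert.insert f S) where
  h4231 := by
    simp only [Set.mem_insert_iff]
    grind
  h35142 p hp q hq s hs t ht h1 h2 := by
    have hp' : p = f := hp.resolve_right (fun hp => by grind)
    have hq' : q = f := hq.resolve_right (fun hp => by grind)
    grind
  h42513 p hp q hq r hr t ht h1 h2 h3 := by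
    have hp' : p = f := hp.resolve_right (fun hp => by grind)
    have hq' : q = f := hq.resolve_right (fun hp => by grind)
    grind
  h351624 p hp q hq s hs t ht u hu h1 h2 := by
    have hp' : p = f := hp.resolve_right (fun hp => by grind)
    have hq' : q = f := hq.resolve_right (fun hp => by grind)
    grind

theorem SplitAvoids.congr {x y : ι → α} {e f : ι} {S : Set ι} (h : SplitAvoids x y e S)
    (hf : ∀ p ∈ S, (x p < x f → x p < x e) ∧ (x f < x p → x e < x p)) : SplitAvoids x y f S where
  h4231 p hp q hq r hr h1 h2 h3 := h.h4231 p hp q hq r hr h1 h2 ((hf r hr).1 h3)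
  h35142 p hp q hq s hs t ht h1 h2 h3 :=
    h.h35142 p hp q hq s hs t ht h1 ((hf q hq).1 h2) ((hf s hs).2 h3)
  h42513 p hp q hq r hr t ht h1 h2 h3 h4 :=
    h.h42513 p hp q hq r hr t ht h1 h2 ((hf r hr).1 h3) ((hf t ht).2 h4)
  h351624 p hp q hq s hs t ht u hu h1 h2 h3 :=
    h.h351624 p hp q hq s hs t ht u hu h1 ((hf q hq).1 h2) ((hf s hs).2 h3)

theorem Shape.splitAvoids {x y : ι → α} {e : ι} {l : List (Letter × ι)} (h : Shape x y e l) :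
    SplitAvoids x y e (points l) := by
  induction l with
  | nil => constructor <;> simp
  | cons s l ih =>
    obtain ⟨s, p⟩ := s
    rw [points_cons]
    cases s <;> simp only [Shape] at h
    · exact (ih h.2.2).insert (forall_mem_points.2 fun q hq => (h.2.1 q hq).2)
        (.inl ⟨forall_mem_points.2 fun q hq _ => (h.2.1 q hq).1, h.1⟩)
    · exact (ih h.2.2).insert (forall_mem_points.2 fun q hq => (h.2.1 q hq).1)
        (.inr (.inl ⟨forall_mem_points.2 fun q hq => (h.2.1 q hq).2, h.1⟩))
    · exact (ih h.2.2).insert (forall_mem_points.2 fun q hq => (h.2.1 q hq).1)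
        (.inr (.inr ⟨forall_mem_points.2 fun q hq => (h.2.1 q hq).2, h.1⟩))
    · exact .insert_of_forall_gt (forall_mem_points.2 h.2.1)

/-- The points are added back in reverse order, each of them lowest at its time, after interchanging
the axes in the case of `d`. A point labelled `a` has nothing to its left; one labelled `b` or `c`
is next to the pivot, so that it cuts the later points exactly as the pivot does. -/
theorem Shape.avoids {x y : ι → α} {e : ι} {l : List (Letter × ι)} (h : Shape x y e l) :
    Avoids x y (points l) := by
  induction l generalizing x y e with
  | nil => constructor <;> simp
  | cons s l ih =>
    have g := h.lt_or_gt
    obtain ⟨s, p⟩ := s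
    simp only [List.mem_cons, forall_eq_or_imp] at g
    rw [points_cons]
    cases s <;> simp only [Shape] at h
    · exact (ih h.2.2).insert (.of_forall_lt (forall_mem_points.2 fun q hq => (h.2.1 q hq).1))
        (forall_mem_points.2 fun q hq => (h.2.1 q hq).2)
    · exact (ih h.2.2).insert (h.2.2.splitAvoids.congr (forall_mem_points.2 (by grind)))
        (forall_mem_points.2 fun q hq => (h.2.1 q hq).1)
    · exact (ih h.2.2).insert (h.2.2.splitAvoids.congr (forall_mem_points.2 (by grind)))
        (forall_mem_points.2 fun q hq => (h.2.1 q hq).1)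
    · exact ((ih h.2.2).insert h.2.2.splitAvoids
        (forall_mem_points.2 fun q hq => h.1.trans (h.2.1 q hq))).swap

theorem FullShape.avoids {x y : ι → α} {l : List (Letter × ι)} (h : FullShape x y l) :
    Avoids x y (points l) := by
  rcases l with _ | ⟨⟨s, p⟩, l⟩
  · simp [FullShape] at h
  · cases s <;> simp only [FullShape] at h
    rw [points_cons]
    exact (h.2.avoids.insert h.2.splitAvoids (forall_mem_points.2 h.1)).swap

theorem containsPattern_of_strictMono {k n : ℕ} {σ : Fin k → ℕ} {π : Equiv.Perm (Fin n)}
    (τ : Fin k → Fin k) (hτ : ∀ i, τ (τ i) = i) (hσ : ∀ i, σ i = τ i + 1) {p : Fin k → Fin n}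
    (hp : StrictMono p) (hπ : StrictMono fun i => π (p (τ i))) : ContainsPattern σ π := by
  refine ⟨OrderEmbedding.ofStrictMono p hp, fun i j => ?_⟩
  have := hπ.lt_iff_lt (a := τ i) (b := τ j)
  simp only [hτ] at this
  simp [hσ, this]

theorem inClassA_iff {n : ℕ} (π : Equiv.Perm (Fin n)) :
    InClassA π ↔ Avoids (fun i => i) (fun i => π i) Set.univ := by
  constructor
  · rintro ⟨h1, h2, h3, h4⟩
    constructor
    · intro p _ q _ r _ s _ e1 e2 e3 e4 e5 e6
      refine h1 (containsPattern_of_strictMono ![3, 1, 2, 0] (by decide) (by decide)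
        (p := ![p, q, r, s]) (Fin.strictMono_iff_lt_succ.2 fun i => ?_)
        (Fin.strictMono_iff_lt_succ.2 fun i => ?_)) <;> fin_cases i <;> assumption
    · intro p _ q _ r _ s _ t _ e1 e2 e3 e4 e5 e6 e7 e8
      refine h2 (containsPattern_of_strictMono ![2, 4, 0, 3, 1] (by decide) (by decide)
        (p := ![p, q, r, s, t]) (Fin.strictMono_iff_lt_succ.2 fun i => ?_)
        (Fin.strictMono_iff_lt_succ.2 fun i => ?_)) <;> fin_cases i <;> assumption
    · intro p _ q _ r _ s _ t _ e1 e2 e3 e4 e5 e6 e7 e8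
      refine h3 (containsPattern_of_strictMono ![3, 1, 4, 0, 2] (by decide) (by decide)
        (p := ![p, q, r, s, t]) (Fin.strictMono_iff_lt_succ.2 fun i => ?_)
        (Fin.strictMono_iff_lt_succ.2 fun i => ?_)) <;> fin_cases i <;> assumption
    · intro p _ q _ r _ s _ t _ u _ e1 e2 e3 e4 e5 e6 e7 e8 e9 e10
      refine h4 (containsPattern_of_strictMono ![2, 4, 0, 5, 1, 3] (by decide) (by decide)
        (p := ![p, q, r, s, t, u]) (Fin.strictMono_iff_lt_succ.2 fun i => ?_)
        (Fin.strictMono_iff_lt_succ.2 fun i => ?_)) <;> fin_cases i <;> assumption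
  · intro h
    refine ⟨?_, ?_, ?_, ?_⟩
    · rintro ⟨f, hf⟩
      refine h.h4231 (f 0) trivial (f 1) trivial (f 2) trivial (f 3) trivial ?_ ?_ ?_
        ((hf _ _).1 ?_) ((hf _ _).1 ?_) ((hf _ _).1 ?_) <;> simp
    · rintro ⟨f, hf⟩
      refine h.h35142 (f 0) trivial (f 1) trivial (f 2) trivial (f 3) trivial (f 4) trivial
        ?_ ?_ ?_ ?_ ((hf _ _).1 ?_) ((hf _ _).1 ?_) ((hf _ _).1 ?_) ((hf _ _).1 ?_) <;> simp
    · rintro ⟨f, hf⟩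
      refine h.h42513 (f 0) trivial (f 1) trivial (f 2) trivial (f 3) trivial (f 4) trivial
        ?_ ?_ ?_ ?_ ((hf _ _).1 ?_) ((hf _ _).1 ?_) ((hf _ _).1 ?_) ((hf _ _).1 ?_) <;> simp
    · rintro ⟨f, hf⟩
      refine h.h351624 (f 0) trivial (f 1) trivial (f 2) trivial (f 3) trivial (f 4) trivial
        (f 5) trivial ?_ ?_ ?_ ?_ ?_ ((hf _ _).1 ?_) ((hf _ _).1 ?_) ((hf _ _).1 ?_)
        ((hf _ _).1 ?_) ((hf _ _).1 ?_) <;> simp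

/-! ### Simplicity of the encoded permutations -/

/-- The set `I` is an interval, horizontally and vertically, of the set `S` of points. -/
def Interval (x y : ι → α) (S I : Set ι) : Prop :=
  I ⊆ S ∧ ∀ p ∈ I, ∀ q ∈ I, ∀ r ∈ S,
    (x p < x r → x r < x q → r ∈ I) ∧ (y p < y r → y r < y q → r ∈ I)

theorem Interval.swap {x y : ι → α} {S I : Set ι} (h : Interval x y S I) : Interval y x S I :=
  ⟨h.1, fun p hp q hq r hr => (h.2 p hp q hq r hr).symm⟩

theorem Interval.diff {x y : ι → α} {S I : Set ι} {p : ι} (h : Interval x y (insert p S) I)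
    (hp : p ∉ S) : Interval x y S (I \ {p}) := by
  refine ⟨fun q hq => (h.1 hq.1).resolve_left hq.2, fun q hq r hr s hs => ?_⟩
  have hsp : s ≠ p := by rintro rfl; exact hp hs
  have := h.2 q hq.1 r hr.1 s (.inr hs)
  exact ⟨fun h1 h2 => ⟨this.1 h1 h2, hsp⟩, fun h1 h2 => ⟨this.2 h1 h2, hsp⟩⟩

theorem isSimple_iff {n : ℕ} (π : Equiv.Perm (Fin n)) :
    IsSimple π ↔ ∀ I, Interval (fun i => i) (fun i => π i) Set.univ I →
      I.Subsingleton ∨ I = Set.univ := by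
  refine forall_congr' fun I => ?_
  rw [← and_imp]
  refine imp_congr_left ⟨?_, ?_⟩
  · rintro ⟨h1, h2⟩
    refine ⟨Set.subset_univ _, fun p hp q hq r _ => ⟨fun h3 h4 => h1.out hp hq ⟨h3.le, h4.le⟩,
      fun h3 h4 => ?_⟩⟩
    have := h2.out (Set.mem_image_of_mem _ hp) (Set.mem_image_of_mem _ hq) ⟨h3.le, h4.le⟩
    simpa using this
  · rintro ⟨-, h⟩
    refine ⟨⟨fun p hp q hq r hr => ?_⟩, ⟨?_⟩⟩
    · rcases hr.1.eq_or_lt with rfl | h1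
      · exact hp
      rcases hr.2.eq_or_lt with rfl | h2
      · exact hq
      exact (h p hp q hq r trivial).1 h1 h2
    · rintro _ ⟨p, hp, rfl⟩ _ ⟨q, hq, rfl⟩ r hr
      rcases hr.1.eq_or_lt with rfl | h1
      · exact ⟨p, hp, rfl⟩
      rcases hr.2.eq_or_lt with rfl | h2
      · exact ⟨q, hq, rfl⟩
      exact ⟨π.symm r, (h p hp q hq (π.symm r) trivial).2 (by simpa using h1) (by simpa using h2),
        by simp⟩

/-- Unless it begins with the letter `a`, an admissible sequence has no point which is both the
leftmost and the lowest one. -/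
theorem Shape.not_corner {x y : ι → α} {e : ι} {l : List (Letter × ι)} (h : Shape x y e l)
    (hl : Admissible (l.map Prod.fst)) (ha : (l.map Prod.fst).head? ≠ some .a)
    (h2 : 2 ≤ l.length) {q : ι} (hq : q ∈ points l) (hx : ∀ r ∈ l, ¬ x r.2 < x q)
    (hy : ∀ r ∈ l, ¬ y r.2 < y q) : False := by
  rcases l with _ | ⟨⟨s, p⟩, l⟩
  · simp at h2
  have hl' : Admissible (l.map Prod.fst) := hl.tail (by rintro h; simp at h; simp [h] at h2)
  rw [points_cons] at hq
  simp only [List.mem_cons, forall_eq_or_imp] at hx hy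
  cases s <;> simp only [Shape] at h
  · simp at ha
  · rcases hq with rfl | ⟨q, hq, rfl⟩
    · obtain ⟨r, hr, hlt⟩ := h.2.2.exists_lt hl'
      exact hx.2 r hr ((h.2.1 r hr).2 hlt)
    · exact hy.1 (h.2.1 q hq).1
  · rcases hq with rfl | ⟨q, hq, rfl⟩
    · obtain ⟨r, hr, hlt⟩ := h.2.2.exists_lt hl'
      exact hx.2 r hr (hlt.trans h.1)
    · exact hy.1 (h.2.1 q hq).1
  · rcases hq with rfl | ⟨q, hq, rfl⟩
    · obtain ⟨r, hr, hlt⟩ := h.2.2.exists_lt hl'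
      exact hy.2 r hr hlt
    · exact hx.1 (h.1.trans (h.2.1 q hq))

/-- An admissible sequence has no nontrivial interval on one side of the pivot. -/
theorem Shape.subsingleton {x y : ι → α} {e : ι} {l : List (Letter × ι)} (h : Shape x y e l)
    (hl : Admissible (l.map Prod.fst)) {I : Set ι} (hI : Interval x y (points l) I)
    (hs : (∀ p ∈ I, x p < x e) ∨ ∀ p ∈ I, x e < x p) : I.Subsingleton := by
  induction l generalizing x y e I with
  | nil => simp [Admissible] at hl
  | cons s l ih =>
    have g := h.lt_or_gt
    obtain ⟨s, p⟩ := s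
    rw [points_cons] at hI
    rcases eq_or_ne l [] with rfl | hne
    · have := hI.1
      simp only [points_nil, insert_empty_eq] at this
      exact Set.subsingleton_singleton.anti this
    have hl' : Admissible (l.map Prod.fst) := hl.tail (by simpa using hne)
    have hp : p ∉ points l := by
      rintro ⟨q, hq, rfl⟩
      cases s <;> simp only [Shape] at h
      · exact lt_irrefl _ (h.2.1 q hq).1
      · exact lt_irrefl _ (h.2.1 q hq).1
      · exact lt_irrefl _ (h.2.1 q hq).1
      · exact lt_asymm h.1 (h.2.1 q hq)
    have hJ := hI.diff hp
    by_cases hpI : p ∈ I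
    swap
    · rw [Set.sdiff_singleton_eq_self hpI] at hJ
      cases s <;> simp only [Shape] at h
      · exact ih h.2.2 hl' hJ hs
      · exact ih h.2.2 hl' hJ hs
      · exact ih h.2.2 hl' hJ hs
      -- An interval that misses the next pivot cannot have points both above and below it.
      · refine ih h.2.2 hl' hJ.swap ?_
        by_contra! hcon
        obtain ⟨⟨q, hq, h1⟩, r, hr, h2⟩ := hcon
        have k := h.2.2.lt_or_gt
        have h1' : y p < y q := by
          obtain ⟨q, hq', rfl⟩ := hJ.1 hq
          exact (k q hq').resolve_left (not_lt.2 h1)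
        have h2' : y r < y p := by
          obtain ⟨r, hr', rfl⟩ := hJ.1 hr
          exact (k r hr').resolve_right (not_lt.2 h2)
        exact hpI ((hI.2 r hr q hq p (.inl rfl)).2 h2' h1')
    · intro q hq q' hq'
      suffices H : ∀ q ∈ I, q = p by rw [H q hq, H q' hq']
      clear hq hq' q q'
      intro q hq
      by_contra hqp
      have hqJ : q ∈ I \ {p} := ⟨hq, hqp⟩
      have hql : q ∈ points l := hJ.1 hqJ
      by_cases hsd : s = .d
      · subst hsd
        simp only [Shape] at h
        obtain ⟨r, hr, rfl⟩ := hql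
        have := h.2.1 r hr
        rcases hs with hs | hs
        · exact lt_asymm this (hs _ hq)
        · exact lt_asymm h.1 (hs _ hpI)
      have h' : Shape x y e l := by cases s <;> first | exact h.2.2 | simp at hsd
      -- Only `I = {p, q}` remains. Then `q` is the lowest of the later points and none of them
      -- separates it horizontally from `p`; each possible second letter contradicts this.
      have hsub : (I \ {p}).Subsingleton :=
        ih h' hl' hJ (hs.imp (fun hs q hq => hs q hq.1) (fun hs q hq => hs q hq.1))
      have hyp : ∀ r ∈ l, y p < y r.2 := by
        intro r hr
        cases s <;> simp only [Shape] at h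
        · exact (h.2.1 r hr).2
        · exact (h.2.1 r hr).1
        · exact (h.2.1 r hr).1
        · simp at hsd
      have hlow : ∀ r ∈ l, ¬ y r.2 < y q := by
        intro r hr hlt
        have : r.2 ∈ I \ {p} :=
          ⟨(hI.2 p hpI q hq r.2 (.inr ⟨r, hr, rfl⟩)).2 (hyp r hr) hlt,
            fun hrp => hp ⟨r, hr, hrp⟩⟩
        rw [hsub this hqJ] at hlt
        exact lt_irrefl _ hlt
      have hmid : ∀ r ∈ l, ¬ (x p < x r.2 ∧ x r.2 < x q) ∧ ¬ (x q < x r.2 ∧ x r.2 < x p) := by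
        intro r hr
        have hrp : r.2 ≠ p := fun hrp => hp ⟨r, hr, hrp⟩
        constructor <;> rintro ⟨h1, h2⟩
        · have : r.2 ∈ I \ {p} := ⟨(hI.2 p hpI q hq r.2 (.inr ⟨r, hr, rfl⟩)).1 h1 h2, hrp⟩
          rw [hsub this hqJ] at h2
          exact lt_irrefl _ h2
        · have : r.2 ∈ I \ {p} := ⟨(hI.2 q hq p hpI r.2 (.inr ⟨r, hr, rfl⟩)).1 h1 h2, hrp⟩
          rw [hsub this hqJ] at h1
          exact lt_irrefl _ h1
      rcases l with _ | ⟨⟨t, r⟩, l⟩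
      · simp at hne
      simp only [List.mem_cons, forall_eq_or_imp] at hlow hmid
      rw [points_cons] at hql
      -- the second letter of the word is the one which encodes the lowest point
      have hqr : t ≠ .d → q = r := by
        intro ht
        refine hql.resolve_right ?_
        rintro ⟨q, hq', rfl⟩
        refine hlow.1 ?_
        cases t <;> simp only [Shape] at h'
        · exact (h'.2.1 q hq').2
        · exact (h'.2.1 q hq').1
        · exact (h'.2.1 q hq').1
        · simp at ht
      have hqd : t = .d → x q < x e → s = .d := by
        rintro rfl hqe
        simp only [Shape] at h'
        have hqr : q = r := by
          refine hql.resolve_right ?_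
          rintro ⟨q, hq', rfl⟩
          exact lt_asymm hqe (h'.2.1 q hq')
        subst hqr
        by_contra hsd
        rcases eq_or_ne l [] with rfl | hl2
        · exact hsd (hl.2.2.1 rfl)
        · obtain ⟨r, hr, hlt⟩ := h'.2.2.exists_lt (hl'.tail (by simpa using hl2))
          exact hlow.2 r hr hlt
      have hl2 : t ≠ .d → ∃ r ∈ l, x r.2 < x e := by
        intro ht
        have := hl'.tail (hl'.ne_nil ht)
        refine Shape.exists_lt (y := y) ?_ this
        cases t <;> first | exact h'.2.2 | simp at ht
      have hst := hl.2.1.1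
      cases s
      · simp only [Shape, List.mem_cons, forall_eq_or_imp] at h
        have hqe : x q < x e := hs.elim (fun hs => hs q hq) fun hs => absurd (hs p hpI) (by grind)
        cases t
        · simp at hst
        · obtain ⟨r, hr, hlt⟩ := hl2 (by simp)
          have := hqr (by simp)
          simp only [Shape] at h'
          subst this
          exact (hmid.2 r hr).1 ⟨(h.2.1.2 r hr).1, (h'.2.1 r hr).2 hlt⟩
        · have := hqr (by simp)
          simp only [Shape] at h'
          subst this
          exact lt_asymm hqe h'.1
        · simp at hqd
          exact not_lt.2 hqd hqe
      · simp only [Shape, List.mem_cons, forall_eq_or_imp] at h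
        have hqe : x q < x e := hs.elim (fun hs => hs q hq) fun hs => absurd (hs p hpI) (by grind)
        cases t
        · obtain ⟨r, hr, hlt⟩ := hl2 (by simp)
          have := hqr (by simp)
          simp only [Shape] at h'
          subst this
          exact (hmid.2 r hr).2 ⟨(h'.2.1 r hr).1, (h.2.1.2 r hr).2 hlt⟩
        · simp at hst
        · have := hqr (by simp)
          simp only [Shape] at h'
          subst this
          exact lt_asymm hqe h'.1
        · simp at hqd
          exact not_lt.2 hqd hqe
      · simp only [Shape, List.mem_cons, forall_eq_or_imp] at h
        have hqe : x e < x q := hs.elim (fun hs => absurd (hs p hpI) (by grind)) fun hs => hs q hq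
        cases t
        · have := hqr (by simp)
          subst this
          exact lt_asymm hqe h'.1
        · have := hqr (by simp)
          subst this
          exact lt_asymm hqe h'.1
        · simp at hst
        · simp only [Shape] at h'
          have hql' : q ∈ points l := hql.resolve_left (by rintro rfl; exact lt_asymm hqe h'.1)
          have hl0 : l ≠ [] := by rintro rfl; simp at hql'
          have hadm : Admissible (l.map Prod.fst) := hl'.tail (by simpa using hl0)
          -- After `cd`, the point `q` would be leftmost and lowest among the points that follow.
          -- The exclusion of `da`, and of a final `cdd` if only one point follows, makes this
          -- impossible.
          refine h'.2.2.not_corner hadm ?_ ?_ hql' hlow.2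
            fun r hr hlt => (hmid.2 r hr).1 ⟨(h.2.1.2 r hr).2 (h'.2.1 r hr), hlt⟩
          · rcases l with _ | ⟨⟨u, _⟩, l⟩
            · simp at hl0
            · simpa using hl'.2.1.2 rfl
          · rcases l with _ | ⟨⟨u, v⟩, _ | ⟨w, l⟩⟩
            · simp at hl0
            · have h1 := hl.2.2.2 rfl
              have h2 : u = .d := hadm
              simp [h2] at h1
            · simp
      · simp at hsd

/-- Slot points lie horizontally between `f` and the pivot `e`, and a point labelled `c` lies
vertically between `e` and a later slot point. At a `d` the pair `(f, e)` is replaced by `(e, p)`,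
with the axes interchanged. -/
theorem Shape.points_subset {x y : ι → α} {e f : ι} {l : List (Letter × ι)} (h : Shape x y e l)
    (hl : Admissible (l.map Prod.fst)) {S I : Set ι} (hI : Interval x y S I) (hS : points l ⊆ S)
    (he : e ∈ I) (hf : f ∈ I) (hef : ∀ q ∈ l, x f < x q.2 ∧ y e < y q.2) : points l ⊆ I := by
  induction l generalizing x y e f with
  | nil => simp
  | cons s l ih =>
    obtain ⟨s, p⟩ := s
    rw [points_cons] at hS ⊢
    rw [Set.insert_subset_iff] at hS ⊢
    simp only [List.mem_cons, forall_eq_or_imp] at hef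
    rcases eq_or_ne l [] with rfl | hne
    · have hs : s = .d := hl
      subst hs
      exact ⟨(hI.2 f hf e he p hS.1).1 hef.1.1 h.1, by simp⟩
    have hl' : Admissible (l.map Prod.fst) := hl.tail (by simpa using hne)
    cases s <;> simp only [Shape] at h
    · exact ⟨(hI.2 f hf e he p hS.1).1 hef.1.1 h.1, ih h.2.2 hl' hI hS.2 he hf hef.2⟩
    · exact ⟨(hI.2 f hf e he p hS.1).1 hef.1.1 h.1, ih h.2.2 hl' hI hS.2 he hf hef.2⟩
    · have := ih h.2.2 hl' hI hS.2 he hf hef.2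
      obtain ⟨q, hq, -⟩ := h.2.2.exists_lt hl'
      exact ⟨(hI.2 e he q.2 (this ⟨q, hq, rfl⟩) p hS.1).2 hef.1.2 (h.2.1 q hq).1, this⟩
    · have := (hI.2 f hf e he p hS.1).1 hef.1.1 h.1
      exact ⟨this, ih h.2.2 hl' hI.swap hS.2 this he
        fun q hq => ⟨(hef.2 q hq).2, h.1.trans (h.2.1 q hq)⟩⟩

theorem FullShape.simple {x y : ι → α} {l : List (Letter × ι)} (h : FullShape x y l)
    (hl : Admissible (l.map Prod.fst)) (hdd : [.d, .d] <+: l.map Prod.fst) (h4 : 4 ≤ l.length)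
    {I : Set ι} (hI : Interval x y (points l) I) : I.Subsingleton ∨ I = points l := by
  rcases l with _ | ⟨⟨s, p⟩, _ | ⟨⟨t, q⟩, l⟩⟩
  · simp at h4
  · simp at h4
  simp only [List.map_cons, List.cons_prefix_cons, List.nil_prefix, and_true] at hdd
  obtain ⟨rfl, rfl⟩ := hdd
  obtain ⟨hp, h⟩ := h
  have hl1 := hl.tail (by simp)
  have hl2 := hl1.tail (by rintro h; simp at h; simp [h] at h4)
  have h' := h
  simp only [Shape] at h
  obtain ⟨hqp, hpl, h⟩ := h
  simp only [List.mem_cons, forall_eq_or_imp] at hp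
  have hp0 : p ∉ points ((.d, q) :: l) := by
    rintro ⟨r, hr, rfl⟩
    rcases List.mem_cons.1 hr with rfl | hr
    · exact lt_irrefl _ hqp
    · exact lt_irrefl _ (hpl r hr)
  rw [points_cons] at hI ⊢
  have hJ := hI.diff hp0
  by_cases hpI : p ∈ I
  swap
  · left
    rw [Set.sdiff_singleton_eq_self hpI] at hJ
    refine h'.subsingleton hl1 hJ.swap ?_
    by_contra! hcon
    obtain ⟨⟨r, hr, h1⟩, s, hs, h2⟩ := hcon
    have k := h'.lt_or_gt
    have h1' : y p < y r := by
      obtain ⟨q, hq', rfl⟩ := hJ.1 hr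
      exact (k q hq').resolve_left (not_lt.2 h1)
    have h2' : y s < y p := by
      obtain ⟨r, hr', rfl⟩ := hJ.1 hs
      exact (k r hr').resolve_right (not_lt.2 h2)
    exact hpI ((hI.2 s hs r hr p (.inl rfl)).2 h2' h1')
  -- With both initial pivots, `I` absorbs everything. Without `q`, the other points of `I` lie
  -- above `p`, so there is at most one of them; it would be a corner of the points after `dd`,
  -- which `not_corner` rules out.
  by_cases hqI : q ∈ I
  · right
    refine hI.1.antisymm (Set.insert_subset hpI ?_)
    rw [points_cons]
    refine Set.insert_subset hqI (h.points_subset hl2 hI ?_ hqI hpI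
      fun r hr => ⟨hp.2 r hr, hqp.trans (hpl r hr)⟩)
    rw [points_cons]
    exact (Set.subset_insert _ _).trans (Set.subset_insert _ _)
  · left
    rw [points_cons] at hJ hI
    have hsub : ∀ r ∈ I \ {p}, r ∈ points l := fun r hr =>
      (hJ.1 hr).resolve_left (by rintro rfl; exact hqI hr.1)
    have hsing : (I \ {p}).Subsingleton := by
      refine h'.subsingleton hl1 (I := I \ {p}) (by rw [points_cons]; exact hJ.swap) (.inr ?_)
      intro r hr
      obtain ⟨r, hr', rfl⟩ := hsub r hr
      exact hpl r hr'
    intro r hr r' hr'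
    suffices H : ∀ r ∈ I, r = p by rw [H r hr, H r' hr']
    clear hr hr' r r'
    intro r hr
    by_contra hrp
    have hrJ : r ∈ I \ {p} := ⟨hr, hrp⟩
    have key : ∀ s ∈ l, s.2 ∈ I → s.2 = r := fun s hs hsI =>
      hsing ⟨hsI, by rintro h; exact hp0 (by rw [points_cons, ← h]; exact .inr ⟨s, hs, rfl⟩)⟩ hrJ
    refine h.not_corner hl2 ?_ (by simpa using h4) (hsub r hrJ) ?_ ?_
    · rcases l with _ | ⟨⟨u, _⟩, l⟩
      · simp
      · simpa using hl1.2.1.2 rfl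
    · intro s hs hlt
      have := key s hs ((hI.2 p hpI r hr s.2 (.inr (.inr ⟨s, hs, rfl⟩))).1 (hp.2 s hs) hlt)
      rw [this] at hlt
      exact lt_irrefl _ hlt
    · intro s hs hlt
      have := key s hs ((hI.2 p hpI r hr s.2 (.inr (.inr ⟨s, hs, rfl⟩))).2 (hpl s hs) hlt)
      rw [this] at hlt
      exact lt_irrefl _ hlt

/-! ### Uniqueness of the labelling -/

theorem Shape.notMem {x y : ι → α} {e p : ι} {s : Letter} {l : List (Letter × ι)}
    (h : Shape x y e ((s, p) :: l)) : p ∉ points l := by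
  rintro ⟨q, hq, rfl⟩
  cases s <;> simp only [Shape] at h
  · exact lt_irrefl _ (h.2.1 q hq).1
  · exact lt_irrefl _ (h.2.1 q hq).1
  · exact lt_irrefl _ (h.2.1 q hq).1
  · exact lt_asymm h.1 (h.2.1 q hq)

/-- The next pivot is the only point of the slot, so that a letter `d` cannot be confused with
another letter. -/
theorem Shape.eq_d {x y : ι → α} {e p p' : ι} {s : Letter} {l l' : List (Letter × ι)}
    (h : Shape x y e ((.d, p) :: l)) (h' : Shape x y e ((s, p') :: l'))
    (hl : Admissible (((.d, p) :: l).map Prod.fst)) (hl' : Admissible (((s, p') :: l').map Prod.fst))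
    (hpts : points ((.d, p) :: l) = points ((s, p') :: l')) : s = .d := by
  by_contra hs
  have hadm : Admissible (l'.map Prod.fst) := hl'.tail (hl'.ne_nil hs)
  have hsh : Shape x y e l' := by cases s <;> first | exact h'.2.2 | simp at hs
  obtain ⟨r, hr, hlt⟩ := hsh.exists_lt hadm
  have hslot : ∀ i ∈ points ((s, p') :: l'), x i < x e → i = p := by
    intro i hi hie
    rw [← hpts, points_cons] at hi
    refine hi.resolve_right ?_
    rintro ⟨q, hq, rfl⟩
    exact lt_asymm hie (h.2.1 q hq)
  have hrp : r.2 = p := hslot _ (by rw [points_cons]; exact .inr ⟨r, hr, rfl⟩) hlt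
  have hp'p : p' ≠ p := by
    rintro rfl
    exact h'.notMem ⟨r, hr, hrp⟩
  have hp' : ¬ x p' < x e := fun hlt => hp'p (hslot _ (by rw [points_cons]; exact .inl rfl) hlt)
  cases s
  · exact hp' h'.1
  · exact hp' h'.1
  swap
  · simp at hs
  rcases l' with _ | ⟨⟨t, r'⟩, l'⟩
  · simp at hr
  -- Here `s = .c`. A further `a` or `b` would need a slot point besides `p`, and `cc` is forbidden.
  have ht : t = .d := by
    by_contra ht
    have hadm' := hadm.tail (hadm.ne_nil ht)
    have hsh' : Shape x y e l' := by cases t <;> first | exact hsh.2.2 | simp at ht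
    obtain ⟨u, hu, hlt'⟩ := hsh'.exists_lt hadm'
    have hup : u.2 = p := hslot _ (by rw [points_cons]; exact .inr ⟨u, by simp [hu], rfl⟩) hlt'
    have hr' : r' ≠ p := by
      rintro rfl
      exact hsh.notMem ⟨u, hu, hup⟩
    have hr'p : ¬ x r' < x e := fun hlt =>
      hr' (hslot _ (by rw [points_cons]; exact .inr ⟨_, List.mem_cons_self, rfl⟩) hlt)
    cases t
    · exact hr'p hsh.1
    · exact hr'p hsh.1
    · have := hl'.2.1.1 rfl
      simp at this
    · exact ht rfl
  subst ht
  simp only [Shape, List.mem_cons, forall_eq_or_imp] at h h' hsh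
  obtain rfl : r' = p := by
    refine hslot _ (by rw [points_cons, points_cons]; exact .inr (.inl rfl)) hsh.1
  have hp'l : p' ∈ points l := by
    have : p' ∈ points ((.d, r') :: l) := by rw [hpts, points_cons]; exact .inl rfl
    rw [points_cons] at this
    exact this.resolve_left hp'p
  have hmem : ∀ q ∈ l, q.2 = p' ∨ q.2 ∈ points l' := by
    intro q hq
    have : q.2 ∈ points ((.d, r') :: l) := by rw [points_cons]; exact .inr ⟨q, hq, rfl⟩
    rw [hpts, points_cons, points_cons] at this
    refine this.imp_right fun h0 => h0.resolve_left fun h0 => ?_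
    have := h.2.1 q hq
    rw [h0] at this
    exact lt_asymm this hsh.1
  have hl0 : l ≠ [] := by rintro rfl; simp at hp'l
  have hladm : Admissible (l.map Prod.fst) := hl.tail (by simpa using hl0)
  -- The competing words begin with `d` and `cd`. The point announced by that `c` is a corner of
  -- what follows the `d` in the first word, which would require the factor `da`.
  refine h.2.2.not_corner hladm ?_ ?_ hp'l ?_ ?_
  · rcases l with _ | ⟨⟨u, _⟩, l⟩
    · simp at hl0
    · simpa using hl.2.1.2 rfl
  · rcases l' with _ | ⟨⟨u, v⟩, l'⟩
    · have := hl'.1.symm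
      have h2 := hl'.2.2.2 rfl
      have h3 := hadm
      simp [Admissible] at hl'
    · have hv : v ∈ points ((.d, r') :: l) := by
        rw [hpts, points_cons, points_cons, points_cons]
        exact .inr (.inr (.inl rfl))
      have hvr : v ≠ r' := by
        rintro rfl
        exact Shape.notMem (x := x) (y := y) (e := e) (s := .d) (p := v) hsh
          (by rw [points_cons]; exact .inl rfl)
      rw [points_cons] at hv
      obtain ⟨q, hq, hqv⟩ := hv.resolve_left hvr
      obtain ⟨q', hq', hqv'⟩ := hp'l
      have hne : q ≠ q' := by
        rintro rfl
        have := (h'.2.1.2 (u, v) (by simp)).1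
        rw [← hqv, hqv'] at this
        exact lt_irrefl _ this
      rcases l with _ | ⟨w, _ | ⟨w', l⟩⟩
      · simp at hq
      · simp at hq hq'
        exact absurd (hq.trans hq'.symm) hne
      · simp
  · intro q hq hlt
    rcases hmem q hq with h0 | ⟨q', hq', h0⟩
    · rw [h0] at hlt
      exact lt_irrefl _ hlt
    · rw [← h0] at hlt
      exact lt_asymm hlt (h'.2.1.2 q' hq').1
  · intro q hq hlt
    rcases hmem q hq with h0 | ⟨q', hq', h0⟩
    · rw [h0] at hlt
      exact lt_irrefl _ hlt
    · rw [← h0] at hlt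
      exact lt_asymm hlt ((h'.2.1.2 q' hq').2 (hsh.2.1 q' hq'))

theorem Shape.lowest {x y : ι → α} {e p : ι} {s : Letter} {l : List (Letter × ι)}
    (h : Shape x y e ((s, p) :: l)) (hs : s ≠ .d) : ∀ i ∈ points l, y p < y i := by
  rintro _ ⟨q, hq, rfl⟩
  cases s <;> simp only [Shape] at h
  · exact (h.2.1 q hq).2
  · exact (h.2.1 q hq).1
  · exact (h.2.1 q hq).1
  · simp at hs

/-- The labels of an admissible sequence are determined by its points. -/
theorem Shape.unique {x y : ι → α} {e : ι} {l l' : List (Letter × ι)}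
    (h : Shape x y e l) (h' : Shape x y e l') (hl : Admissible (l.map Prod.fst))
    (hl' : Admissible (l'.map Prod.fst)) (hpts : points l = points l') : l = l' := by
  induction l generalizing x y e l' with
  | nil => simp [Admissible] at hl
  | cons s l ih =>
    rcases l' with _ | ⟨⟨s', p'⟩, l'⟩
    · simp [Admissible] at hl'
    obtain ⟨s, p⟩ := s
    have hsd : s = .d ↔ s' = .d := by
      constructor
      · rintro rfl
        exact h.eq_d h' hl hl' hpts
      · rintro rfl
        exact h'.eq_d h hl' hl hpts.symm
    have hp := h.notMem
    have hp' := h'.notMem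
    have hp1 : p ∈ points ((s', p') :: l') := by rw [← hpts, points_cons]; exact .inl rfl
    have hp1' : p' ∈ points ((s, p) :: l) := by rw [hpts, points_cons]; exact .inl rfl
    rw [points_cons] at hp1 hp1'
    have hpp : p = p' := by
      by_contra hne
      have h1 := hp1.resolve_left hne
      have h1' := hp1'.resolve_left (Ne.symm hne)
      by_cases hs : s = .d
      · have hs' := hsd.1 hs
        subst hs hs'
        obtain ⟨q, hq, rfl⟩ := h1
        exact lt_asymm h.1 (h'.2.1 q hq)
      · exact lt_asymm (h.lowest hs _ h1') (h'.lowest (fun hs' => hs (hsd.2 hs')) _ h1)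
    subst hpp
    have hpts' : points l = points l' := by
      rw [points_cons, points_cons] at hpts
      ext i
      have := Set.ext_iff.1 hpts i
      simp only [Set.mem_insert_iff] at this
      by_cases hi : i = p
      · subst hi
        exact ⟨fun h => absurd h hp, fun h => absurd h hp'⟩
      · simpa [hi] using this
    by_cases hs : s = .d
    · have hs' := hsd.1 hs
      subst hs hs'
      rcases eq_or_ne l [] with rfl | hne
      · rcases l' with _ | ⟨r, l'⟩
        · rfl
        · rw [points_cons, points_nil] at hpts'
          exact absurd hpts'.symm (Set.insert_nonempty _ _).ne_empty
      · have hne' : l' ≠ [] := by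
          rintro rfl
          obtain ⟨r, l, rfl⟩ := List.exists_cons_of_ne_nil hne
          rw [points_cons, points_nil] at hpts'
          exact absurd hpts' (Set.insert_nonempty _ _).ne_empty
        rw [ih h.2.2 h'.2.2 (hl.tail (by simpa using hne)) (hl'.tail (by simpa using hne')) hpts']
    · have hs' : s' ≠ .d := fun hs' => hs (hsd.2 hs')
      have hadm := hl.tail (hl.ne_nil hs)
      have hadm' := hl'.tail (hl'.ne_nil hs')
      have hsh : Shape x y e l := by cases s <;> first | exact h.2.2 | simp at hs
      have hsh' : Shape x y e l' := by cases s' <;> first | exact h'.2.2 | simp at hs'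
      have hll := ih hsh hsh' hadm hadm' hpts'
      subst hll
      -- A later slot point `r` tells `a` from `b`: the announced point lies to the left of `r` or
      -- to its right.
      obtain ⟨r, hr, hlt⟩ := hsh.exists_lt hadm
      suffices s = s' by rw [this]
      cases s <;> cases s' <;> simp only [Shape] at h h' <;> first | rfl | grind

theorem FullShape.unique {x y : ι → α} {l l' : List (Letter × ι)}
    (h : FullShape x y l) (h' : FullShape x y l') (hl : Admissible (l.map Prod.fst))
    (hl' : Admissible (l'.map Prod.fst)) (h2 : 2 ≤ l.length) (h2' : 2 ≤ l'.length)
    (hpts : points l = points l') : l = l' := by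
  rcases l with _ | ⟨⟨s, p⟩, l⟩
  · simp at h2
  rcases l' with _ | ⟨⟨s', p'⟩, l'⟩
  · simp at h2'
  cases s <;> simp only [FullShape] at h
  cases s' <;> simp only [FullShape] at h'
  have hp : p ∉ points l := by rintro ⟨q, hq, rfl⟩; exact lt_irrefl _ (h.1 q hq)
  have hp' : p' ∉ points l' := by rintro ⟨q, hq, rfl⟩; exact lt_irrefl _ (h'.1 q hq)
  have hp1 : p ∈ points ((.d, p') :: l') := by rw [← hpts, points_cons]; exact .inl rfl
  have hp1' : p' ∈ points ((.d, p) :: l) := by rw [hpts, points_cons]; exact .inl rfl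
  rw [points_cons] at hp1 hp1'
  have hpp : p = p' := by
    by_contra hne
    obtain ⟨q, hq, rfl⟩ := hp1.resolve_left hne
    obtain ⟨q', hq', rfl⟩ := hp1'.resolve_left (Ne.symm hne)
    exact lt_asymm (h.1 _ hq') (h'.1 _ hq)
  subst hpp
  have hpts' : points l = points l' := by
    rw [points_cons, points_cons] at hpts
    ext i
    have := Set.ext_iff.1 hpts i
    simp only [Set.mem_insert_iff] at this
    by_cases hi : i = p
    · subst hi
      exact ⟨fun h => absurd h hp, fun h => absurd h hp'⟩
    · simpa [hi] using this
  rw [h.2.unique h'.2 (hl.tail (by rintro h; simp at h; simp [h] at h2))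
    (hl'.tail (by rintro h; simp at h; simp [h] at h2')) hpts']

/-! ### Existence of the labelling -/

/-- A finite set of points above a pivot `e` which can be read as an admissible sequence: the points
to the left of the pivot form a nonempty slot. -/
structure Config (x y : ι → α) (e : ι) (F : Finset ι) : Prop where
  low : ∀ p ∈ F, y e < y p
  nonempty : ∃ p ∈ F, x p < x e
  avoids : Avoids x y (insert e F)
  simple : ∀ I, Interval x y F I → ((∀ p ∈ I, x p < x e) ∨ ∀ p ∈ I, x e < x p) → I.Subsingleton
  corner : ∀ p ∈ F, x e < x p → ∃ q ∈ F, x p < x q ∨ y p < y q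

theorem Config.lt_or_gt {x y : ι → α} {e : ι} {F : Finset ι} (h : Config x y e F)
    (hx : x.Injective) {p : ι} (hp : p ∈ F) : x p < x e ∨ x e < x p := by
  refine lt_or_gt_of_ne fun hpe => ?_
  have := h.low p hp
  rw [hx hpe] at this
  exact lt_irrefl _ this

/-- The removed point is lowest and is extreme on its side of the pivot, or lies on the other side;
hence it separates no two points of an interval of the rest that keeps to one side, and such
intervals were intervals before. -/
theorem Config.erase [DecidableEq ι] {x y : ι → α} {e : ι} {F : Finset ι} (h : Config x y e F)
    {p : ι} (hlow : ∀ q ∈ F, y p ≤ y q) (hslot : ∃ q ∈ F, q ≠ p ∧ x q < x e)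
    (hp : (x p < x e ∧ ∀ q ∈ F, x q < x e → x p ≤ x q) ∨
      (x p < x e ∧ ∀ q ∈ F, x q < x e → x q ≤ x p) ∨
      (x e < x p ∧ ∀ q ∈ F, x e < x q → x p ≤ x q)) : Config x y e (F.erase p) where
  low q hq := h.low q (Finset.mem_of_mem_erase hq)
  nonempty := by
    obtain ⟨q, hq, hqp, hlt⟩ := hslot
    exact ⟨q, Finset.mem_erase.2 ⟨hqp, hq⟩, hlt⟩
  avoids := h.avoids.mono (Set.insert_subset_insert (by simp))
  simple I hI hs := by
    refine h.simple I ⟨fun q hq => Finset.mem_of_mem_erase (hI.1 hq), fun q hq r hr z hz => ?_⟩ hs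
    have hq' := Finset.mem_of_mem_erase (hI.1 hq)
    have hr' := Finset.mem_of_mem_erase (hI.1 hr)
    by_cases hzp : z = p
    · subst hzp
      refine ⟨fun h1 h2 => ?_, fun h1 h2 => absurd (hlow q hq') (not_le.2 h1)⟩
      exfalso
      rcases hs with hs | hs <;> have hsq := hs q hq <;> have hsr := hs r hr <;>
        rcases hp with hp | hp | hp
      · exact not_lt.2 (hp.2 q hq' hsq) h1
      · exact not_lt.2 (hp.2 r hr' hsr) h2
      · exact not_lt.2 hsr.le (hp.1.trans h2)
      · exact not_lt.2 hsq.le (h1.trans hp.1)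
      · exact not_lt.2 hsq.le (h1.trans hp.1)
      · exact not_lt.2 (hp.2 q hq' hsq) h1
    · exact hI.2 q hq r hr z (Finset.mem_erase.2 ⟨hzp, hz⟩)
  corner r hr hlt := by
    have hr' := Finset.mem_of_mem_erase hr
    obtain ⟨q, hq, h1⟩ := h.corner r hr' hlt
    refine ⟨q, Finset.mem_erase.2 ⟨?_, hq⟩, h1⟩
    rintro rfl
    rcases h1 with h1 | h1
    · rcases hp with hp | hp | hp
      · order
      · order
      · exact not_lt.2 (hp.2 r hr' hlt) h1
    · exact not_lt.2 (hlow r hr') h1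

/-- The new slot consists of the points below `q`. If it were empty, all points beyond the old pivot
would form an interval, hence a single point, and that point would be rightmost and highest. The
field `corner` exists to exclude this. -/
theorem Config.next [DecidableEq ι] {x y : ι → α} {e : ι} {F : Finset ι} (h : Config x y e F)
    (hx : x.Injective) (hy : y.Injective) {q : ι} (hq : q ∈ F) (hqe : x q < x e)
    (huniq : ∀ p ∈ F, x p < x e → p = q) (hne : (F.erase q).Nonempty) :
    Config y x q (F.erase q) := by
  have hright : ∀ p ∈ F.erase q, x e < x p := by
    intro p hp
    obtain ⟨hpq, hp⟩ := Finset.mem_erase.1 hp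
    exact (h.lt_or_gt hx hp).resolve_left fun hlt => hpq (huniq p hp hlt)
  refine ⟨fun p hp => hqe.trans (hright p hp), ?_, ?_, ?_, ?_⟩
  · by_contra! hcon
    have hlt : ∀ p ∈ F.erase q, y q < y p := fun p hp =>
      (hcon p hp).lt_of_ne fun hpq => (Finset.mem_erase.1 hp).1 (hy hpq.symm)
    have hsub : (F.erase q : Set ι).Subsingleton := by
      refine h.simple _ ⟨fun p hp => Finset.mem_of_mem_erase hp, fun p hp r hr z hz => ?_⟩
        (.inr hright)
      rw [Finset.mem_coe, Finset.mem_erase]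
      refine ⟨fun h1 h2 => ⟨?_, hz⟩, fun h1 h2 => ⟨?_, hz⟩⟩
      · rintro rfl
        have := hright p hp
        order
      · rintro rfl
        have := hlt p hp
        order
    obtain ⟨p, hp⟩ := hne
    obtain ⟨r, hr, h1⟩ := h.corner p (Finset.mem_of_mem_erase hp) (hright p hp)
    by_cases hrq : r = q
    · subst hrq
      have := hright p hp
      have := hlt p hp
      rcases h1 with h1 | h1 <;> order
    · have := hsub hp (Finset.mem_coe.2 (Finset.mem_erase.2 ⟨hrq, hr⟩))
      subst this
      rcases h1 with h1 | h1 <;> exact lt_irrefl _ h1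
  · refine h.avoids.swap.mono ?_
    rintro p (rfl | hp)
    · exact .inr hq
    · exact .inr (Finset.mem_of_mem_erase hp)
  · intro I hI hs
    have hI' := hI.1
    refine h.simple I ⟨fun p hp => Finset.mem_of_mem_erase (hI' hp), fun p hp r hr z hz => ?_⟩
      (.inr fun p hp => hright p (hI' hp))
    by_cases hzq : z = q
    · subst hzq
      refine ⟨fun h1 h2 => ?_, fun h1 h2 => ?_⟩
      · have := hright p (hI' hp)
        order
      · rcases hs with hs | hs
        · have := hs r hr
          order
        · have := hs p hp
          order
    · exact hI.swap.2 p hp r hr z (Finset.mem_erase.2 ⟨hzq, hz⟩)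
  · intro p hp hlt
    obtain ⟨r, hr, h1⟩ := h.corner p (Finset.mem_of_mem_erase hp) (hright p hp)
    refine ⟨r, Finset.mem_erase.2 ⟨?_, hr⟩, h1.symm⟩
    rintro rfl
    have := hright p hp
    rcases h1 with h1 | h1 <;> order

/-- If the slot has at least two points, then no point below the slot is preceded, beyond the pivot,
by a point which is not below the slot. -/
theorem Config.below_slot {x y : ι → α} {e : ι} {F : Finset ι} (h : Config x y e F)
    (hx : x.Injective) (hy : y.Injective) {q₁ q₂ b c : ι} (hq : q₁ ≠ q₂) (hq₁ : q₁ ∈ F)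
    (hq₂ : q₂ ∈ F) (hqe₁ : x q₁ < x e) (hqe₂ : x q₂ < x e) (hb : b ∈ F)
    (hbq : ∀ q ∈ F, x q < x e → y b < y q) (hc : c ∈ F) (hce : x e < x c) (hcb : x c < x b) :
    ∀ q ∈ F, x q < x e → y c < y q := by
  have hF {p : ι} (hp : p ∈ F) : p ∈ (insert e F : Set ι) := .inr hp
  have he : e ∈ (insert e F : Set ι) := .inl rfl
  -- A point between `e` and `b` that vertically separates two slot points completes `35142` (with
  -- `e` as `1`) or `4231`, according to the horizontal order of the slot points; `b` plays the `2`
  -- or the `1`.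
  have hleft : ∀ z ∈ F, x e < x z → x z < x b → ∀ p ∈ F, ∀ q ∈ F, x p < x e → x q < x e →
      y p < y z → y z < y q → False := by
    intro z hz hze hzb p hp q hq hpe hqe h1 h2
    rcases lt_trichotomy (x p) (x q) with hpq | hpq | hpq
    · exact h.avoids.h35142 p (hF hp) q (hF hq) e he z (hF hz) b (hF hb) hpq hqe hze hzb
        (h.low b hb) (hbq p hp hpe) h1 h2
    · rw [hx hpq] at h1
      order
    · exact h.avoids.h4231 q (hF hq) p (hF hp) z (hF hz) b (hF hb) hpq (hpe.trans hze) hzb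
        (hbq p hp hpe) h1 h2
  by_contra! hcon
  obtain ⟨q, hqF, hqe, hqc⟩ := hcon
  have hqc' : y q < y c := hqc.lt_of_ne fun hqc => by
    rw [hy hqc] at hqe
    order
  have habove : ∀ q ∈ F, x q < x e → y q < y c := by
    intro r hr hre
    by_contra! hrc
    refine hleft c hc hce hcb q hqF r hr hqe hre hqc' (hrc.lt_of_ne fun hrc => ?_)
    rw [hy hrc] at hce
    order
  -- Now `c` lies above the whole slot and plays the largest entry: a separating point to the right
  -- of `b` completes `351624` or `42513`. Hence nothing separates the slot, which is thus an
  -- interval with at least two points.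
  have hright : ∀ z ∈ F, x b < x z → ∀ p ∈ F, ∀ q ∈ F, x p < x e → x q < x e →
      y p < y z → y z < y q → False := by
    intro z hz hzb p hp q hq hpe hqe h1 h2
    rcases lt_trichotomy (x p) (x q) with hpq | hpq | hpq
    · exact h.avoids.h351624 p (hF hp) q (hF hq) e he c (hF hc) b (hF hb) z (hF hz) hpq hqe hce hcb
        hzb (h.low b hb) (hbq p hp hpe) h1 h2 (habove q hq hqe)
    · rw [hx hpq] at h1
      order
    · exact h.avoids.h42513 q (hF hq) p (hF hp) c (hF hc) b (hF hb) z (hF hz) hpq (hpe.trans hce)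
        hcb hzb (hbq p hp hpe) h1 h2 (habove q hq hqe)
  have hsub : {z | z ∈ F ∧ x z < x e}.Subsingleton := by
    refine h.simple _ ⟨fun z hz => hz.1, fun p hp q hq z hz => ⟨fun h1 h2 => ⟨hz, h2.trans hq.2⟩,
      fun h1 h2 => ⟨hz, ?_⟩⟩⟩ (.inl fun z hz => hz.2)
    by_contra hze
    have hze' := (h.lt_or_gt hx hz).resolve_left hze
    rcases lt_trichotomy (x z) (x b) with hzb | hzb | hzb
    · exact hleft z hz hze' hzb p hp.1 q hq.1 hp.2 hq.2 h1 h2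
    · rw [hx hzb] at h1
      exact lt_asymm h1 (hbq p hp.1 hp.2)
    · exact hright z hz hzb p hp.1 q hq.1 hp.2 hq.2 h1 h2
  exact hq (hsub ⟨hq₁, hqe₁⟩ ⟨hq₂, hqe₂⟩)

/-- If the slot has at least two points, then the lowest point is at one of the three places which
are encoded by the letters `a`, `b`, `c`. -/
theorem Config.lowest_mem {x y : ι → α} {e : ι} {F : Finset ι} (h : Config x y e F)
    (hx : x.Injective) (hy : y.Injective) {q₁ q₂ p : ι} (hq : q₁ ≠ q₂) (hq₁ : q₁ ∈ F)
    (hq₂ : q₂ ∈ F) (hqe₁ : x q₁ < x e) (hqe₂ : x q₂ < x e) (hp : p ∈ F)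
    (hlow : ∀ q ∈ F, y p ≤ y q) :
    (x p < x e ∧ ∀ q ∈ F, x q < x e → x p ≤ x q) ∨
      (x p < x e ∧ ∀ q ∈ F, x q < x e → x q ≤ x p) ∨
      (x e < x p ∧ ∀ q ∈ F, x e < x q → x p ≤ x q) := by
  have hF {p : ι} (hp : p ∈ F) : p ∈ (insert e F : Set ι) := .inr hp
  have he : e ∈ (insert e F : Set ι) := .inl rfl
  have hlt {q : ι} (hq : q ∈ F) (hqp : x q ≠ x p) : y p < y q :=
    (hlow q hq).lt_of_ne fun heq => hqp (by rw [hy heq])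
  rcases h.lt_or_gt hx hp with hpe | hpe
  · by_contra! hcon
    obtain ⟨l, hl, hle, hlp⟩ := hcon.1 hpe
    obtain ⟨r, hr, hre, hpr⟩ := hcon.2.1 hpe
    -- By `4231` with the pivot as `1`, the slot points to the left of `p` are lower than those to
    -- its right. Together with `42513` this makes the part of the slot up to `p` an interval.
    have hlr : ∀ l ∈ F, ∀ r ∈ F, x l < x p → x p < x r → x r < x e → y l < y r := by
      intro l hl r hr hlp hpr hre
      by_contra! hrl
      refine h.avoids.h4231 l (hF hl) p (hF hp) r (hF hr) e he hlp hpr hre (h.low p hp)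
        (hlt hr hpr.ne') (hrl.lt_of_ne fun heq => ?_)
      rw [hy heq] at hpr
      order
    have hsub : {z | z ∈ F ∧ x z ≤ x p}.Subsingleton := by
      refine h.simple _ ⟨fun z hz => hz.1, fun i hi j hj z hz =>
        ⟨fun h1 h2 => ⟨hz, h2.le.trans hj.2⟩, fun h1 h2 => ⟨hz, ?_⟩⟩⟩
        (.inl fun z hz => hz.2.trans_lt hpe)
      by_contra! hzp
      have hjp : x j < x p := hj.2.lt_of_ne fun heq => by
        rw [hx heq] at h2
        exact not_lt.2 (hlow i hi.1) (h1.trans h2)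
      rcases h.lt_or_gt hx hz with hze | hze
      · exact lt_asymm h2 (hlr j hj.1 z hz hjp hzp hze)
      · exact h.avoids.h42513 j (hF hj.1) p (hF hp) r (hF hr) e he z (hF hz) hjp hpr hre hze
          (h.low p hp) (hlt hz hzp.ne') h2 (hlr j hj.1 r hr hjp hpr hre)
    have := hsub ⟨hl, hlp.le⟩ ⟨hp, le_rfl⟩
    rw [this] at hlp
    exact lt_irrefl _ hlp
  · refine .inr (.inr ⟨hpe, ?_⟩)
    by_contra! hcon
    obtain ⟨c, hc, hce, hcp⟩ := hcon
    have hb := fun b hb hbq c hc hce hcb =>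
      h.below_slot hx hy hq hq₁ hq₂ hqe₁ hqe₂ (b := b) (c := c) hb hbq hc hce hcb
    have hpq : ∀ q ∈ F, x q < x e → y p < y q := fun q hq hqe => hlt hq (hqe.trans hpe).ne
    -- The points beyond the pivot and below the whole slot form an interval by `below_slot`; it
    -- would contain both `c` and `p`.
    have hsub : {z | z ∈ F ∧ x e < x z ∧ ∀ q ∈ F, x q < x e → y z < y q}.Subsingleton := by
      refine h.simple _ ⟨fun z hz => hz.1, fun i hi j hj z hz => ⟨fun h1 h2 => ?_, fun h1 h2 => ?_⟩⟩
        (.inr fun z hz => hz.2.1)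
      · have hez := hi.2.1.trans h1
        exact ⟨hz, hez, hb j hj.1 hj.2.2 z hz hez h2⟩
      · refine ⟨hz, (h.lt_or_gt hx hz).resolve_left fun hze => ?_,
          fun q hq hqe => h2.trans (hj.2.2 q hq hqe)⟩
        exact lt_asymm h2 (hj.2.2 z hz hze)
    have := hsub ⟨hc, hce, hb p hp hpq c hc hce hcp⟩ ⟨hp, hpe, hpq⟩
    rw [this] at hcp
    exact lt_irrefl _ hcp

/-- Two points announced in succession at the same place are neighbours in both directions and lie
on the same side of the pivot. -/
theorem Config.not_repeat {x y : ι → α} {e : ι} {F : Finset ι} (h : Config x y e F) {s : Letter}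
    (hs : s ≠ .d) {p r : ι} {l : List (Letter × ι)} (hl : Shape x y e ((s, p) :: (s, r) :: l))
    (hF : points ((s, p) :: (s, r) :: l) = F) : False := by
  have hpr : p ≠ r := by
    rintro rfl
    exact hl.notMem (by rw [points_cons]; exact .inl rfl)
  have g := hl.lt_or_gt
  have hint : Interval x y F {p, r} := by
    rw [← hF, points_cons, points_cons]
    refine ⟨by rintro z (rfl | rfl) <;> simp, ?_⟩
    rintro i hi j hj z (rfl | rfl | ⟨q, hq, rfl⟩)
    · simp
    · simp
    · simp only [List.mem_cons, forall_eq_or_imp] at g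
      have := g.2.2 q hq
      simp only [Set.mem_insert_iff, Set.mem_singleton_iff] at hi hj ⊢
      cases s <;> simp only [Shape, List.mem_cons, forall_eq_or_imp] at hl <;> grind
  refine hpr (h.simple _ hint ?_ (.inl rfl) (.inr rfl))
  simp only [Set.mem_insert_iff, Set.mem_singleton_iff, forall_eq_or_imp, forall_eq]
  cases s <;> simp only [Shape] at hl
  · exact .inl ⟨hl.1, hl.2.2.1⟩
  · exact .inl ⟨hl.1, hl.2.2.1⟩
  · exact .inr ⟨hl.1, hl.2.2.1⟩
  · simp at hs

theorem points_cons_of_erase [DecidableEq ι] {F : Finset ι} {p : ι} (hp : p ∈ F) {s : Letter}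
    {l : List (Letter × ι)} (hl : points l = F.erase p) : points ((s, p) :: l) = F := by
  rw [points_cons, hl]
  simp [hp]

/-- A slot with at least two points yields `a`, `b` or `c` through `lowest_mem`. A single slot point
`q` normally yields `d`, except that a corner of the remaining points is taken first, as `c`. -/
theorem Config.exists_shape {x y : ι → α} {e : ι} {F : Finset ι} (h : Config x y e F)
    (hx : x.Injective) (hy : y.Injective) :
    ∃ l, Shape x y e l ∧ Admissible (l.map Prod.fst) ∧ points l = F := by
  classical
  induction hn : F.card using Nat.strong_induction_on generalizing x y e F with
  | _ n ih =>
  have ih' : ∀ {x y : ι → α} {e : ι} {p : ι}, p ∈ F → Config x y e (F.erase p) → x.Injective →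
      y.Injective → ∃ l, Shape x y e l ∧ Admissible (l.map Prod.fst) ∧ points l = F.erase p :=
    fun hp hc hx hy => ih _ (hn ▸ Finset.card_erase_lt_of_mem hp) hc hx hy rfl
  clear ih
  obtain ⟨q, hq, hqe⟩ := h.nonempty
  by_cases huniq : ∀ p ∈ F, x p < x e → p = q
  · rcases (F.erase q).eq_empty_or_nonempty with h0 | hne
    · refine ⟨[(.d, q)], ⟨hqe, by simp, trivial⟩, rfl, points_cons_of_erase hq ?_⟩
      simp [h0]
    have hnext := h.next hx hy hq hqe huniq hne
    -- This is the case in which `cd` and `da` compete. If only one point remains besides `q`, it is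
    -- a corner trivially, and the reading has to be `dd`; hence the bound on the cardinality.
    by_cases hc : ∃ p ∈ F.erase q, (∀ r ∈ F.erase q, y p ≤ y r ∧ x p ≤ x r) ∧
        2 ≤ (F.erase q).card
    · obtain ⟨p, hp, hpr, hcard⟩ := hc
      obtain ⟨hpq, hpF⟩ := Finset.mem_erase.1 hp
      have hpe : x e < x p := (h.lt_or_gt hx hpF).resolve_left fun hlt => hpq (huniq p hpF hlt)
      have hyq : y p < y q := by
        obtain ⟨r, hr, hlt⟩ := hnext.nonempty
        exact (hpr r hr).1.trans_lt hlt
      have hlow : ∀ r ∈ F, y p ≤ y r := by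
        intro r hr
        by_cases hrq : r = q
        · exact hrq ▸ hyq.le
        · exact (hpr r (Finset.mem_erase.2 ⟨hrq, hr⟩)).1
      have hleft : ∀ r ∈ F, x e < x r → x p ≤ x r := fun r hr hre =>
        (hpr r (Finset.mem_erase.2 ⟨by rintro rfl; order, hr⟩)).2
      obtain ⟨l, hl1, hl2, hl3⟩ := ih' hpF (h.erase hlow ⟨q, hq, Ne.symm hpq, hqe⟩
        (.inr (.inr ⟨hpe, hleft⟩))) hx hy
      have hpts := points_cons_of_erase (s := .c) hpF hl3
      have hsh : Shape x y e ((.c, p) :: l) := by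
        have hmem : ∀ r ∈ l, r.2 ≠ p ∧ r.2 ∈ F := fun r hr => by
          have : r.2 ∈ points l := ⟨r, hr, rfl⟩
          rw [hl3] at this
          exact Finset.mem_erase.1 this
        refine ⟨hpe, fun r hr => ⟨(hlow _ (hmem r hr).2).lt_of_ne
          fun heq => (hmem r hr).1 (hy heq.symm), fun hre => (hleft _ (hmem r hr).2 hre).lt_of_ne
          fun heq => (hmem r hr).1 (hx heq.symm)⟩, hl1⟩
      refine ⟨(.c, p) :: l, hsh, ?_, hpts⟩
      rcases l with _ | ⟨⟨t, r⟩, l⟩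
      · simp [Admissible] at hl2
      refine ⟨hl2, ⟨?_, by simp⟩, ?_, ?_⟩
      · rintro rfl
        exact (h.not_repeat (by simp) hsh hpts).elim
      · intro hl0
        have : l = [] := by simpa using hl0
        subst this
        have h1 : (F : Set ι) ⊆ {p, r} := by
          rw [← hpts, points_cons, points_cons]
          simp
        have h2 : F ⊆ {p, r} := by simpa [← Finset.coe_subset] using h1
        have h3 := Finset.card_le_card h2
        have h4 := Finset.card_le_two (a := p) (b := r)
        have h5 := Finset.card_erase_lt_of_mem hq
        omega
      · rintro - hdd
        rcases l with _ | ⟨⟨t', r'⟩, _ | ⟨_, l⟩⟩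
        · simp at hdd
        swap
        · simp at hdd
        simp only [List.map_cons, List.map_nil, List.cons.injEq, and_true] at hdd
        obtain ⟨rfl, rfl⟩ := hdd
        have hFs : (F : Set ι) = {p, r, r'} := by
          rw [← hpts, points_cons, points_cons, points_cons]
          simp
        have hrF : r ∈ F := by rw [← Finset.mem_coe, hFs]; simp
        have hr'F : r' ∈ F := by rw [← Finset.mem_coe, hFs]; simp
        simp only [Shape, List.mem_cons, List.not_mem_nil, or_false, forall_eq,
          forall_eq_or_imp] at hsh
        have hrq : r = q := huniq r hrF hsh.2.2.1
        subst hrq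
        have hpr' : p ≠ r' := by
          rintro rfl
          exact lt_irrefl _ hsh.2.1.2.1
        have hr'y : y r' < y r := hsh.2.2.2.2.1
        -- In a final `cdd` the points of the `c` and of the last `d` are the only ones beyond the
        -- pivot, and both are lower than the point of the first `d`; they form an interval.
        refine hpr' (h.simple {p, r'} ⟨?_, ?_⟩ (.inr ?_) (.inl rfl) (.inr rfl))
        · rw [hFs]
          rintro z (rfl | rfl) <;> simp
        · rw [hFs]
          rintro i hi j hj z (rfl | rfl | rfl)
          · simp
          · simp only [Set.mem_insert_iff, Set.mem_singleton_iff] at hi hj ⊢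
            grind
          · simp
        · simp only [Set.mem_insert_iff, Set.mem_singleton_iff, forall_eq_or_imp, forall_eq]
          exact ⟨hpe, hsh.2.2.2.1⟩
    · obtain ⟨l, hl1, hl2, hl3⟩ := ih' hq hnext hy hx
      refine ⟨(.d, q) :: l, ⟨hqe, ?_, hl1⟩, ?_, points_cons_of_erase hq hl3⟩
      · intro r hr
        have : r.2 ∈ points l := ⟨r, hr, rfl⟩
        rw [hl3] at this
        obtain ⟨h1, h2⟩ := Finset.mem_erase.1 this
        exact (h.lt_or_gt hx h2).resolve_left fun hlt => h1 (huniq _ h2 hlt)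
      rcases l with _ | ⟨⟨t, r⟩, l⟩
      · simp [Admissible] at hl2
      refine ⟨hl2, ⟨by simp, ?_⟩, by simp, by simp⟩
      rintro - rfl
      refine hc ⟨r, ?_, ?_, ?_⟩
      · rw [← Finset.mem_coe, ← hl3, points_cons]
        exact .inl rfl
      · intro z hz
        rw [← Finset.mem_coe, ← hl3, points_cons] at hz
        rcases hz with rfl | ⟨z, hz, rfl⟩
        · exact ⟨le_rfl, le_rfl⟩
        · exact ⟨(hl1.2.1 z hz).1.le, (hl1.2.1 z hz).2.le⟩
      · rcases l with _ | ⟨⟨t', r'⟩, l⟩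
        · simp [Admissible] at hl2
        have hr : r ∈ F.erase q := by
          rw [← Finset.mem_coe, ← hl3, points_cons]
          exact .inl rfl
        have hr' : r' ∈ F.erase q := by
          rw [← Finset.mem_coe, ← hl3, points_cons, points_cons]
          exact .inr (.inl rfl)
        refine Finset.one_lt_card.2 ⟨r, hr, r', hr', ?_⟩
        rintro rfl
        exact hl1.notMem (by rw [points_cons]; exact .inl rfl)
  · push Not at huniq
    obtain ⟨q', hq', hqe', hqq⟩ := huniq
    obtain ⟨p, hp, hlow⟩ := F.exists_min_image y ⟨q, hq⟩
    have hplace := h.lowest_mem hx hy hqq hq' hq hqe' hqe hp hlow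
    have hslot : ∃ z ∈ F, z ≠ p ∧ x z < x e := by
      by_cases hqp : q = p
      · exact ⟨q', hq', fun h => hqq (h.trans hqp.symm), hqe'⟩
      · exact ⟨q, hq, hqp, hqe⟩
    obtain ⟨l, hl1, hl2, hl3⟩ := ih' hp (h.erase hlow hslot hplace) hx hy
    have hmem : ∀ r ∈ l, r.2 ≠ p ∧ r.2 ∈ F := fun r hr => by
      have : r.2 ∈ points l := ⟨r, hr, rfl⟩
      rw [hl3] at this
      exact Finset.mem_erase.1 this
    have hlow' : ∀ r ∈ l, y p < y r.2 := fun r hr =>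
      (hlow _ (hmem r hr).2).lt_of_ne fun heq => (hmem r hr).1 (hy heq.symm)
    have hxne : ∀ r ∈ l, x r.2 ≠ x p := fun r hr heq => (hmem r hr).1 (hx heq)
    obtain ⟨s, hs, hsh⟩ : ∃ s : Letter, s ≠ .d ∧ Shape x y e ((s, p) :: l) := by
      rcases hplace with hpl | hpl | hpl
      · refine ⟨.a, by simp, hpl.1, fun r hr => ⟨?_, hlow' r hr⟩, hl1⟩
        rcases h.lt_or_gt hx (hmem r hr).2 with h1 | h1
        · exact (hpl.2 _ (hmem r hr).2 h1).lt_of_ne (hxne r hr).symm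
        · exact hpl.1.trans h1
      · exact ⟨.b, by simp, hpl.1, fun r hr => ⟨hlow' r hr, fun h1 =>
          (hpl.2 _ (hmem r hr).2 h1).lt_of_ne (hxne r hr)⟩, hl1⟩
      · exact ⟨.c, by simp, hpl.1, fun r hr => ⟨hlow' r hr, fun h1 =>
          (hpl.2 _ (hmem r hr).2 h1).lt_of_ne (hxne r hr).symm⟩, hl1⟩
    have hpts := points_cons_of_erase (s := s) hp hl3
    refine ⟨(s, p) :: l, hsh, ?_, hpts⟩
    rcases l with _ | ⟨⟨t, r⟩, l⟩
    · simp [Admissible] at hl2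
    refine ⟨hl2, ⟨?_, fun h => absurd h hs⟩, ?_, ?_⟩
    · rintro rfl
      exact (h.not_repeat hs hsh hpts).elim
    · intro hl0
      have : l = [] := by simpa using hl0
      subst this
      have hFs : (F : Set ι) = {p, r} := by
        rw [← hpts, points_cons, points_cons]
        simp
      have hqs : q ∈ ({p, r} : Set ι) := by rwa [← hFs]
      have hqs' : q' ∈ ({p, r} : Set ι) := by rwa [← hFs]
      -- With only two points left, both belong to the slot, so that `F` itself is an interval on
      -- one side of the pivot.
      have := h.simple F ⟨subset_rfl, fun _ _ _ _ z hz => ⟨fun _ _ => hz, fun _ _ => hz⟩⟩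
        (.inl (by
          rw [hFs]
          simp only [Set.mem_insert_iff, Set.mem_singleton_iff, forall_eq_or_imp, forall_eq]
            at hqs hqs' ⊢
          grind))
      exact absurd (this hq' hq) hqq
    · rintro rfl hdd
      rcases l with _ | ⟨⟨t', r'⟩, _ | ⟨_, l⟩⟩
      · simp at hdd
      swap
      · simp at hdd
      simp only [List.map_cons, List.map_nil, List.cons.injEq, and_true] at hdd
      obtain ⟨rfl, rfl⟩ := hdd
      have hFs : (F : Set ι) = {p, r, r'} := by
        rw [← hpts, points_cons, points_cons, points_cons]
        simp
      have hqs : q ∈ ({p, r, r'} : Set ι) := by rwa [← hFs]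
      have hqs' : q' ∈ ({p, r, r'} : Set ι) := by rwa [← hFs]
      simp only [Shape, List.mem_cons, List.not_mem_nil, or_false, forall_eq,
        forall_eq_or_imp] at hsh
      simp only [Set.mem_insert_iff, Set.mem_singleton_iff] at hqs hqs'
      grind

/-- The leftmost point is a pivot for the others once the axes are interchanged. Simplicity makes
its slot nonempty and excludes a highest rightmost point. The hypothesis `hsec` is the coordinate
form of `π(2) ≠ 1`. -/
theorem exists_fullShape {x y : ι → α} {F : Finset ι} (hx : x.Injective) (hy : y.Injective)
    (hav : Avoids x y F) (hsimple : ∀ I, Interval x y F I → I.Subsingleton ∨ I = F)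
    (h3 : 3 ≤ F.card)
    (hsec : ∀ p ∈ F, ∀ r ∈ F, (∀ q ∈ F, x p ≤ x q) → (∀ q ∈ F, q ≠ p → x r ≤ x q) →
      (∀ q ∈ F, y r ≤ y q) → r = p) :
    ∃ l, FullShape x y l ∧ Admissible (l.map Prod.fst) ∧ [.d, .d] <+: l.map Prod.fst ∧
      points l = F := by
  classical
  obtain ⟨p, hp, hmin⟩ := F.exists_min_image x (Finset.card_pos.1 (by omega))
  have hlt : ∀ q ∈ F.erase p, x p < x q := by
    intro q hq
    obtain ⟨h1, h2⟩ := Finset.mem_erase.1 hq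
    exact (hmin q h2).lt_of_ne fun heq => h1 (hx heq.symm)
  have herase : ∀ r ∈ F, Interval x y F (F.erase r) → False := by
    intro r hr hI
    rcases hsimple _ hI with h1 | h1
    · have h4 : (F.erase r).card ≤ 1 := Finset.card_le_one.2 fun a ha b hb => h1 ha hb
      rw [Finset.card_erase_of_mem hr] at h4
      omega
    · have h5 : r ∈ (F.erase r : Set ι) := by rw [h1]; exact hr
      simp at h5
  have hc : Config y x p (F.erase p) := by
    refine ⟨hlt, ?_, ?_, ?_, ?_⟩
    · by_contra! hcon
      refine herase p hp ⟨by simp, fun q hq r hr z hz => ?_⟩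
      rw [Finset.mem_coe, Finset.mem_erase]
      refine ⟨fun h1 h2 => ⟨?_, hz⟩, fun h1 h2 => ⟨?_, hz⟩⟩
      · rintro rfl
        exact lt_asymm h1 (hlt q hq)
      · rintro rfl
        exact not_lt.2 (hcon q hq) h1
    · refine hav.swap.mono ?_
      rintro q (rfl | hq)
      · exact hp
      · exact Finset.mem_of_mem_erase hq
    · intro I hI hs
      refine (hsimple I ⟨fun q hq => Finset.mem_of_mem_erase (hI.1 hq),
        fun q hq r hr z hz => ?_⟩).resolve_right ?_
      · by_cases hzp : z = p
        · subst hzp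
          refine ⟨fun h1 h2 => absurd (hlt q (hI.1 hq)) h1.asymm, fun h1 h2 => ?_⟩
          rcases hs with hs | hs
          · exact absurd (hs r hr) h2.asymm
          · exact absurd (hs q hq) h1.asymm
        · exact (hI.2 q hq r hr z (Finset.mem_erase.2 ⟨hzp, hz⟩)).symm
      · rintro rfl
        exact (Finset.mem_erase.1 (hI.1 hp)).1 rfl
    · intro q hq hqp
      by_contra! hcon
      have hqF := Finset.mem_of_mem_erase hq
      refine herase q hqF ⟨by simp, fun i hi j hj z hz => ?_⟩
      rw [Finset.mem_coe, Finset.mem_erase]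
      have hj' : y j ≤ y q ∧ x j ≤ x q := by
        by_cases hjp : j = p
        · exact hjp ▸ ⟨hqp.le, hmin q hqF⟩
        · exact hcon j (Finset.mem_erase.2 ⟨hjp, Finset.mem_of_mem_erase hj⟩)
      refine ⟨fun h1 h2 => ⟨?_, hz⟩, fun h1 h2 => ⟨?_, hz⟩⟩
      · rintro rfl
        exact not_lt.2 hj'.2 h2
      · rintro rfl
        exact not_lt.2 hj'.1 h2
  obtain ⟨l, hl1, hl2, hl3⟩ := hc.exists_shape hy hx
  have hpts := points_cons_of_erase (s := .d) hp hl3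
  have hlt' : ∀ q ∈ l, x p < x q.2 := fun q hq => hlt _ (by
    rw [← Finset.mem_coe, ← hl3]
    exact ⟨q, hq, rfl⟩)
  rcases l with _ | ⟨⟨t, r⟩, l⟩
  · simp [Admissible] at hl2
  have hr : r ∈ F.erase p := by
    rw [← Finset.mem_coe, ← hl3, points_cons]
    exact .inl rfl
  obtain ⟨hrp, hrF⟩ := Finset.mem_erase.1 hr
  have hF : ∀ q ∈ F, q = p ∨ q = r ∨ ∃ z ∈ l, z.2 = q := by
    intro q hq
    rw [← Finset.mem_coe, ← hpts, points_cons, points_cons] at hq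
    exact hq
  have hpr : Interval x y F {p, r} → False := by
    intro hI
    rcases hsimple _ hI with h1 | h1
    · exact hrp (h1 (.inr rfl) (.inl rfl))
    · have h1' : F = {p, r} := Finset.coe_injective (by rw [← h1]; simp)
      have h4 := Finset.card_le_two (a := p) (b := r)
      rw [← h1'] at h4
      omega
  have hpr' : (∀ q ∈ l, (x p < x q.2 ∧ x r < x q.2) ∧
      (y q.2 < y p ∧ y q.2 < y r ∨ y p < y q.2 ∧ y r < y q.2)) → False := by
    intro hq
    refine hpr ⟨by rintro z (rfl | rfl) <;> assumption, ?_⟩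
    intro i hi j hj z hz
    rcases hF z hz with rfl | rfl | ⟨q, hql, rfl⟩
    · simp
    · simp
    · have := hq q hql
      simp only [Set.mem_insert_iff, Set.mem_singleton_iff] at hi hj ⊢
      grind
  have hl1' := hl1
  have g := hl1.lt_or_gt
  simp only [List.mem_cons, forall_eq_or_imp] at g hlt'
  -- After the first `d`, a letter `a` means that the second point from the left is the lowest one,
  -- against `hsec`; with `b` or `c`, that second point has a height adjacent to that of `p`, and
  -- the two form an interval.
  have ht : t = .d := by
    cases t <;> simp only [Shape] at hl1'
    · refine absurd (hsec p hp r hrF hmin ?_ ?_) hrp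
      · intro q hq hqp
        rcases hF q hq with rfl | rfl | ⟨q, hql, rfl⟩
        · exact absurd rfl hqp
        · exact le_rfl
        · exact (hl1'.2.1 q hql).2.le
      · intro q hq
        rcases hF q hq with rfl | rfl | ⟨q, hql, rfl⟩
        · exact hl1'.1.le
        · exact le_rfl
        · exact (hl1'.2.1 q hql).1.le
    · exact (hpr' fun q hq => by grind).elim
    · exact (hpr' fun q hq => by grind).elim
    · rfl
  subst ht
  refine ⟨(.d, p) :: (.d, r) :: l, ⟨by simpa using hlt', hl1⟩, ⟨hl2, by simp, by simp, by simp⟩,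
    by simp, hpts⟩

end HullPerm

namespace HullPerm

variable {σ : Type*}

/-! ### The code language and its regularity -/

theorem admissible_iff (w : List Letter) : Admissible w ↔
    (w = [.d] ∨ [.d, .d] <:+ w) ∧ ¬ [.a, .a] <:+: w ∧ ¬ [.b, .b] <:+: w ∧ ¬ [.c, .c] <:+: w ∧
      ¬ [.c, .d, .d] <:+ w ∧ ¬ [.d, .a] <:+: w := by
  induction w with
  | nil => simp [Admissible]
  | cons s u ih =>
    rcases u with _ | ⟨t, u⟩
    · simp [Admissible, List.infix_cons_iff, List.suffix_cons_iff]
    · rw [Admissible, ih]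
      simp only [List.infix_cons_iff (a := s), List.suffix_cons_iff (a := s),
        List.cons_prefix_cons, List.nil_prefix, and_true, List.cons.injEq]
      have h1 : [Letter.d, .d] <:+ t :: u → u ≠ [] := by
        rintro h rfl
        have := h.length_le
        simp at this
      cases s <;> cases t <;> simp <;> grind

/-- The condition on the prefix `dda` is implied by the absence of the factor `da`. -/
theorem mem_codeLanguage_iff {w : List Letter} :
    w ∈ codeLanguage ↔ 4 ≤ w.length ∧ [.d, .d] <+: w ∧ Admissible w := by
  rw [admissible_iff]
  have h1 : [Letter.d, .d, .a] <+: w → [Letter.d, .a] <:+: w := by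
    rintro ⟨u, rfl⟩
    exact ⟨[.d], u, rfl⟩
  have h2 : 4 ≤ w.length → w ≠ [.d] := by
    rintro h rfl
    simp at h
  change (4 ≤ w.length ∧ [.d, .d] <+: w ∧ [.d, .d] <:+ w ∧
    ¬ [.a, .a] <:+: w ∧ ¬ [.b, .b] <:+: w ∧ ¬ [.c, .c] <:+: w ∧
    ¬ [.d, .d, .a] <+: w ∧ ¬ [.c, .d, .d] <:+ w ∧ ¬ [.d, .a] <:+: w) ↔ _
  tauto

theorem cons_mem_codeLanguage {w : List Letter} (hw : w ∈ codeLanguage) : [.d] <+: w :=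
  (show [Letter.d] <+: [.d, .d] by simp).trans (mem_codeLanguage_iff.1 hw).2.1

instance : Finite Letter :=
  @Finite.of_fintype _ (Fintype.ofList [.a, .b, .c, .d] (by intro s; cases s <;> simp))

/-- By Myhill–Nerode, finitely many left quotients suffice. After at least four letters the length
and the initial `dd` are settled, and a quotient is empty or depends only on the last three letters:
with three letters still ahead, the conditions on the end of the word do not yet concern the letter
that is dropped. -/
theorem isRegular_codeLanguage : codeLanguage.IsRegular := by
  apply Language.IsRegular.of_finite_range_leftQuotient
  have hT (s t u x : Letter) : (∀ v, ¬ Admissible (s :: t :: u :: x :: v)) ∨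
      ∀ v, Admissible (s :: t :: u :: x :: v) ↔ Admissible (t :: u :: x :: v) := by
    by_cases h : (s = t → s = .d) ∧ (s = .d → t ≠ .a)
    · exact .inr fun v => ⟨fun h' => h'.1, fun h' => ⟨h', h, by simp, by simp⟩⟩
    · exact .inl fun v h' => h h'.2.1
  have key : ∀ w : List Letter, 4 ≤ w.length → codeLanguage.leftQuotient w = 0 ∨
      ∃ s : Letter × Letter × Letter, codeLanguage.leftQuotient w =
        {v | Admissible (s.1 :: s.2.1 :: s.2.2 :: v)} := by
    intro w
    induction w using List.reverseRecOn with
    | nil => simp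
    | append_singleton w x ih =>
      intro hw
      rw [List.length_append, List.length_singleton] at hw
      rcases (by omega : 4 ≤ w.length ∨ w.length = 3) with h | h
      · rw [Language.leftQuotient_append]
        rcases ih h with h | ⟨⟨s, t, u⟩, h⟩
        · left
          rw [h]
          rfl
        · rw [h]
          rcases hT s t u x with h | h
          · exact .inl (Set.eq_empty_of_forall_notMem h)
          · exact .inr ⟨(t, u, x), Set.ext h⟩
      · obtain ⟨s, t, u, rfl⟩ := List.length_eq_three.1 h
        have hmem (v : List Letter) : v ∈ codeLanguage.leftQuotient ([s, t, u] ++ [x]) ↔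
            (s = .d ∧ t = .d) ∧ Admissible (s :: t :: u :: x :: v) := by
          rw [Language.mem_leftQuotient, mem_codeLanguage_iff]
          simp [eq_comm]
        by_cases hst : s = .d ∧ t = .d
        · rcases hT s t u x with h | h
          · exact .inl (Set.eq_empty_of_forall_notMem fun v hv => h v ((hmem v).1 hv).2)
          · exact .inr ⟨(t, u, x), Set.ext fun v => (hmem v).trans
              ((and_iff_right hst).trans (h v))⟩
        · exact .inl (Set.eq_empty_of_forall_notMem fun v hv => hst ((hmem v).1 hv).1)
  refine Set.Finite.subset (((List.finite_length_le Letter 3).image codeLanguage.leftQuotient).union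
    ((Set.finite_singleton 0).union (Set.finite_range fun s : Letter × Letter × Letter =>
      ({v | Admissible (s.1 :: s.2.1 :: s.2.2 :: v)} : Language Letter)))) ?_
  rintro _ ⟨w, rfl⟩
  by_cases hw : w.length ≤ 3
  · exact .inl ⟨w, hw, rfl⟩
  · rcases key w (by omega) with h | ⟨s, h⟩
    · exact .inr (.inl h)
    · exact .inr (.inr ⟨s, h.symm⟩)

/-! ### Generating functions of sets of words -/

/-- The weight of a word, if the letter `s` has the weight `wt s`. -/
noncomputable def weight (wt : Letter → σ →₀ ℕ) (w : List Letter) : σ →₀ ℕ := (w.map wt).sum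

/-- Finiteness is what makes `Set.ncard` additive on disjoint unions in `wordGF_union`. -/
theorem finite_weight {wt : Letter → σ →₀ ℕ} (hwt : ∀ s, wt s ≠ 0) (m : σ →₀ ℕ) :
    {w | weight wt w = m}.Finite := by
  refine (List.finite_length_le Letter m.degree).subset ?_
  rintro w rfl
  change w.length ≤ _
  induction w with
  | nil => simp
  | cons s w ih =>
    have : (wt s).degree ≠ 0 := by simpa [Finsupp.degree_eq_zero_iff] using hwt s
    have h : weight wt (s :: w) = wt s + weight wt w := by simp [weight]
    rw [h, map_add, List.length_cons]
    omega

/-- The generating function of a set of words. -/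
noncomputable def wordGF (wt : Letter → σ →₀ ℕ) (S : Set (List Letter)) : MvPowerSeries σ ℤ :=
  fun m => ({w | w ∈ S ∧ weight wt w = m}.ncard : ℤ)

theorem coeff_wordGF (wt : Letter → σ →₀ ℕ) (S : Set (List Letter)) (m : σ →₀ ℕ) :
    MvPowerSeries.coeff m (wordGF wt S) = ({w | w ∈ S ∧ weight wt w = m}.ncard : ℤ) := rfl

theorem wordGF_union {wt : Letter → σ →₀ ℕ} (hwt : ∀ s, wt s ≠ 0) {S T : Set (List Letter)}
    (h : Disjoint S T) : wordGF wt (S ∪ T) = wordGF wt S + wordGF wt T := by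
  ext m
  rw [map_add, coeff_wordGF, coeff_wordGF, coeff_wordGF, ← Nat.cast_add,
    ← Set.ncard_union_eq _ ((finite_weight hwt m).subset fun w hw => hw.2)
      ((finite_weight hwt m).subset fun w hw => hw.2)]
  · congr 2
    ext w
    simp only [Set.mem_union, Set.mem_ofPred_eq]
    tauto
  · exact h.mono (fun w hw => hw.1) fun w hw => hw.1

theorem wordGF_cons (wt : Letter → σ →₀ ℕ) (s : Letter) (S : Set (List Letter)) :
    wordGF wt ((s :: ·) '' S) = MvPowerSeries.monomial (wt s) 1 * wordGF wt S := by
  classical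
  ext m
  rw [MvPowerSeries.coeff_monomial_mul, coeff_wordGF]
  have hw (w) : weight wt (s :: w) = wt s + weight wt w := by simp [weight]
  split_ifs with h
  · rw [one_mul, coeff_wordGF, ← Set.ncard_image_of_injective
      {w | w ∈ S ∧ weight wt w = m - wt s} (List.cons_injective (a := s))]
    congr 2
    ext w
    constructor
    · rintro ⟨⟨u, hu, rfl⟩, hm⟩
      exact ⟨u, ⟨hu, by rw [← hm, hw, add_tsub_cancel_left]⟩, rfl⟩
    · rintro ⟨u, ⟨hu, hm⟩, rfl⟩
      exact ⟨⟨u, hu, rfl⟩, by rw [hw, hm, add_tsub_cancel_of_le h]⟩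
  · have : {w | w ∈ (s :: ·) '' S ∧ weight wt w = m} = ∅ := by
      rw [Set.eq_empty_iff_forall_notMem]
      rintro _ ⟨⟨u, -, rfl⟩, rfl⟩
      exact h (by rw [hw]; exact le_self_add)
    rw [this]
    simp

theorem wordGF_nil (wt : Letter → σ →₀ ℕ) : wordGF wt {[]} = 1 := by
  classical
  ext m
  rw [coeff_wordGF, MvPowerSeries.coeff_one]
  split_ifs with h
  · subst h
    have : {w | w ∈ ({[]} : Set (List Letter)) ∧ weight wt w = 0} = {[]} := by
      ext w
      simp only [Set.mem_singleton_iff, Set.mem_ofPred_eq, and_iff_left_iff_imp]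
      rintro rfl
      rfl
    rw [this]
    simp
  · have : {w | w ∈ ({[]} : Set (List Letter)) ∧ weight wt w = m} = ∅ := by
      ext w
      simp only [Set.mem_singleton_iff, Set.mem_ofPred_eq, Set.mem_empty_iff_false, iff_false]
      rintro ⟨rfl, rfl⟩
      exact h rfl
    rw [this]
    simp

/-- The admissible words that begin with a given letter. -/
def admissibleFrom (s : Letter) : Set (List Letter) := {w | Admissible w ∧ w.head? = some s}

theorem disjoint_admissibleFrom {s t : Letter} (h : s ≠ t) {S T : Set (List Letter)}
    (hS : S ⊆ admissibleFrom s) (hT : T ⊆ admissibleFrom t) : Disjoint S T := by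
  rw [Set.disjoint_left]
  intro w hw hw'
  have := (hS hw).2.symm.trans (hT hw').2
  simp [h] at this

/-- Splitting admissible words by their first letter gives a linear system. General weights allow
one elimination to serve both the refined count and the count by length. -/
theorem wordGF_codeLanguage {wt : Letter → σ →₀ ℕ} (hwt : ∀ s, wt s ≠ 0)
    {x : Letter → MvPowerSeries σ ℤ} (hx : ∀ s, x s = MvPowerSeries.monomial (wt s) 1) :
    wordGF wt codeLanguage * (1 - 2 * x .a * x .b * x .c - x .a * x .c - x .a * x .b -
      x .b * x .d - x .b * x .c - x .b * x .c * x .d - x .c * x .d - x .d) =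
      x .d ^ 4 * (1 + x .b) := by
  have hcons (s : Letter) (S : Set (List Letter)) :
      wordGF wt ((s :: ·) '' S) = x s * wordGF wt S := by rw [wordGF_cons, hx]
  -- The word `d` may follow only a `d`, and `dd` may not follow a `c`; so `a` and `b` can precede
  -- `D₁`, while `c` can precede only `D₂`.
  set D₁ := admissibleFrom .d \ {[.d]} with hD₁
  set D₂ := D₁ \ {[.d, .d]} with hD₂
  have hD₁d : D₁ ⊆ admissibleFrom .d := Set.sdiff_subset
  have hD₂d : D₂ ⊆ admissibleFrom .d := Set.sdiff_subset.trans hD₁d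
  have hsub (s : Letter) : admissibleFrom s ⊆ admissibleFrom s := subset_rfl
  have hunion {s t u : Letter} {T : Set (List Letter)} (h1 : s ≠ t) (h2 : s ≠ u) (h3 : t ≠ u)
      (hT : T ⊆ admissibleFrom u) :
      wordGF wt (admissibleFrom s ∪ admissibleFrom t ∪ T) =
        wordGF wt (admissibleFrom s) + wordGF wt (admissibleFrom t) + wordGF wt T := by
    rw [wordGF_union hwt, wordGF_union hwt (disjoint_admissibleFrom h1 (hsub s) (hsub t))]
    exact Set.disjoint_union_left.2
      ⟨disjoint_admissibleFrom h2 (hsub s) hT, disjoint_admissibleFrom h3 (hsub t) hT⟩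
  have eA : wordGF wt (admissibleFrom .a) = x .a *
      (wordGF wt (admissibleFrom .b) + wordGF wt (admissibleFrom .c) + wordGF wt D₁) := by
    rw [← hunion (u := .d) (by simp) (by simp) (by simp) hD₁d, ← hcons]
    congr 1
    ext w
    rcases w with _ | ⟨s, _ | ⟨t, u⟩⟩
    · simp [admissibleFrom]
    · cases s <;> simp [admissibleFrom, Admissible, D₁]
    · cases s <;> cases t <;> simp [admissibleFrom, Admissible, D₁]
      all_goals exact fun h => h.ne_nil (by simp)
  have eB : wordGF wt (admissibleFrom .b) = x .b *
      (wordGF wt (admissibleFrom .a) + wordGF wt (admissibleFrom .c) + wordGF wt D₁) := by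
    rw [← hunion (u := .d) (by simp) (by simp) (by simp) hD₁d, ← hcons]
    congr 1
    ext w
    rcases w with _ | ⟨s, _ | ⟨t, u⟩⟩
    · simp [admissibleFrom]
    · cases s <;> simp [admissibleFrom, Admissible, D₁]
    · cases s <;> cases t <;> simp [admissibleFrom, Admissible, D₁]
      all_goals exact fun h => h.ne_nil (by simp)
  have eC : wordGF wt (admissibleFrom .c) = x .c *
      (wordGF wt (admissibleFrom .a) + wordGF wt (admissibleFrom .b) + wordGF wt D₂) := by
    rw [← hunion (u := .d) (by simp) (by simp) (by simp) hD₂d, ← hcons]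
    congr 1
    ext w
    rcases w with _ | ⟨s, _ | ⟨t, u⟩⟩
    · simp [admissibleFrom]
    · cases s <;> simp [admissibleFrom, Admissible, D₁, D₂]
    · cases s <;> cases t <;> simp [admissibleFrom, Admissible, D₁, D₂, and_assoc]
      all_goals exact fun h => h.ne_nil (by simp)
  have eD : wordGF wt D₁ = x .d * (wordGF wt (admissibleFrom .b) + wordGF wt (admissibleFrom .c) +
      wordGF wt (admissibleFrom .d)) := by
    rw [← hunion (u := .d) (by simp) (by simp) (by simp) (hsub _), ← hcons]
    congr 1
    ext w
    rcases w with _ | ⟨s, _ | ⟨t, u⟩⟩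
    · simp [admissibleFrom, D₁]
    · cases s <;> simp [admissibleFrom, Admissible, D₁]
    · cases s <;> cases t <;> simp [admissibleFrom, Admissible, D₁]
  have e1 : wordGF wt (admissibleFrom .d) = wordGF wt D₁ + x .d := by
    have h1 : wordGF wt {[.d]} = x .d := by
      rw [← mul_one (x .d), ← wordGF_nil wt, ← hcons]
      simp
    rw [← h1, ← wordGF_union hwt Set.disjoint_sdiff_left, Set.sdiff_union_of_subset]
    simp [admissibleFrom, Admissible]
  have e2 : wordGF wt D₁ = wordGF wt D₂ + x .d ^ 2 := by
    have h1 : wordGF wt {[.d, .d]} = x .d ^ 2 := by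
      have := hcons .d ((.d :: ·) '' {[]})
      rw [hcons .d {[]}, wordGF_nil, mul_one, ← sq] at this
      simpa using this
    rw [← h1, ← wordGF_union hwt Set.disjoint_sdiff_left, Set.sdiff_union_of_subset]
    simp [admissibleFrom, Admissible, D₁]
  -- After the initial `d`, removing `d` and `dd` from the possible remainders amounts to requiring
  -- length at least four.
  have eL : wordGF wt codeLanguage = x .d * wordGF wt D₂ := by
    rw [← hcons]
    congr 1
    ext w
    change w ∈ codeLanguage ↔ _
    rw [mem_codeLanguage_iff]
    rcases w with _ | ⟨s, _ | ⟨t, _ | ⟨v, _ | ⟨z, u⟩⟩⟩⟩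
    · simp
    · simp [admissibleFrom, D₁, D₂]
    · cases s <;> cases t <;> simp [admissibleFrom, D₁, D₂]
    · cases s <;> cases t <;> cases v <;> simp [admissibleFrom, Admissible, D₁, D₂]
    · cases s <;> cases t <;> simp [admissibleFrom, Admissible, D₁, D₂]
  generalize x .a = a, x .b = b, x .c = c, x .d = d at *
  rw [eL]
  -- The factor `1 - b * c - a * b - a * c - 2 * a * b * c` is the determinant of the system for the
  -- words from `a`, `b`, `c`; the multipliers of `eA`, `eB`, `eC` are the combinations that
  -- eliminate these three series from `eD`.
  linear_combination d * (d * (b + c + 2 * b * c) * eA + d * (1 + c) * eB + d * (1 + b) * eC +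
    (1 - b * c - a * b - a * c - 2 * a * b * c) * (eD + d * e1) -
    (d * (b + c + 2 * b * c) * (-a) + d * (1 + c) * (-b) +
      (1 - b * c - a * b - a * c - 2 * a * b * c) * (1 - d)) * e2)

end HullPerm

namespace HullPerm

/-! ### The bijection -/

theorem points_eq_univ {n : ℕ} {w : List Letter} {π : Equiv.Perm (Fin n)}
    {l : List (Letter × Fin n)} (h : IsLabelling w π l) : points l = Set.univ :=
  Set.eq_univ_of_forall h.2.2.1

theorem IsLabelling.length_eq {n : ℕ} {w : List Letter} {π : Equiv.Perm (Fin n)}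
    {l : List (Letter × Fin n)} (h : IsLabelling w π l) : l.length = w.length := by
  rw [← h.1, List.length_map]

theorem Encodes.isSimpleInA {n : ℕ} {w : List Letter} {π : Equiv.Perm (Fin n)}
    (hw : w ∈ codeLanguage) (h : Encodes w π) : IsSimpleInA π ∧ SecondNeOne π := by
  have hn := h.length_eq
  obtain ⟨l, hl⟩ := (encodes_iff (cons_mem_codeLanguage hw)).1 h
  obtain ⟨h4, hdd, hadm⟩ := mem_codeLanguage_iff.1 hw
  have hu := points_eq_univ hl
  have hlen := hl.length_eq
  obtain ⟨rfl, -, -, hfull⟩ := hl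
  refine ⟨⟨by omega, ?_, ?_⟩, ?_⟩
  · rw [isSimple_iff, ← hu]
    intro I hI
    exact hfull.simple hadm hdd (by omega) hI
  · rw [inClassA_iff, ← hu]
    exact hfull.avoids
  · rcases l with _ | ⟨⟨s, p⟩, _ | ⟨⟨t, q⟩, l⟩⟩
    · simp at hdd
    · simp at hdd
    simp only [List.map_cons, List.cons_prefix_cons, List.nil_prefix, and_true] at hdd
    obtain ⟨rfl, rfl⟩ := hdd
    obtain ⟨hp, hs⟩ := hfull
    have hladm := (hadm.tail (by simp)).tail
      (by rintro h; simp at h; simp [h] at h4)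
    simp only [Shape, List.mem_cons, forall_eq_or_imp] at hp hs
    obtain ⟨r, hr, hlt⟩ := hs.2.2.exists_lt hladm
    intro i hi h0
    have hpr := hp.2 r hr
    rw [points_cons, points_cons] at hu
    have hiu : i ∈ (Set.univ : Set (Fin n)) := trivial
    have h1 := hs.1
    have h2 := hp.1
    rw [← hu] at hiu
    rcases hiu with rfl | rfl | ⟨z, hz, rfl⟩
    · rw [Fin.lt_def] at h1
      omega
    · rw [Fin.lt_def] at hlt hpr
      omega
    · have h3 := hs.2.1 z hz
      rw [Fin.lt_def] at h1 h3
      omega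

theorem Shape.nodup {ι α : Type*} [LinearOrder α] {x y : ι → α} {e : ι} {l : List (Letter × ι)}
    (h : Shape x y e l) : (l.map Prod.snd).Nodup := by
  induction l generalizing x y e with
  | nil => simp
  | cons s l ih =>
    obtain ⟨s, p⟩ := s
    have hp := h.notMem
    rw [List.map_cons, List.nodup_cons, List.mem_map]
    refine ⟨hp, ?_⟩
    cases s <;> simp only [Shape] at h <;> exact ih h.2.2

theorem exists_labelling {n : ℕ} {π : Equiv.Perm (Fin n)} (h : IsSimpleInA π)
    (h' : SecondNeOne π) : ∃ w ∈ codeLanguage, ∃ l, IsLabelling w π l := by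
  obtain ⟨h4, hs, ha⟩ := h
  rw [isSimple_iff] at hs
  rw [inClassA_iff] at ha
  obtain ⟨l, h1, h2, h3, h5⟩ := exists_fullShape (F := Finset.univ) (x := fun i => i)
    (y := fun i => π i) (fun _ _ h => h) π.injective (by simpa using ha) (by simpa using hs)
    (by simp; omega) (by
      intro p _ r _ hp hr hlow
      by_contra hrp
      have hp0 : (p : ℕ) = 0 := by
        have := hp ⟨0, by omega⟩ (Finset.mem_univ _)
        rw [Fin.le_def] at this
        simpa using this
      have hr1 : (r : ℕ) = 1 := by
        have := hr ⟨1, by omega⟩ (Finset.mem_univ _) (fun h0 => by simp [← h0] at hp0)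
        rw [Fin.le_def] at this
        have h0 : (r : ℕ) ≠ 0 := fun h0 => hrp (Fin.ext (by omega))
        simp only at this
        omega
      refine h' r hr1 ?_
      have := hlow (π.symm ⟨0, by omega⟩) (Finset.mem_univ _)
      rw [Fin.le_def] at this
      simpa using this)
  rw [Finset.coe_univ] at h5
  have hnd : (l.map Prod.snd).Nodup := by
    rcases l with _ | ⟨⟨s, p⟩, l⟩
    · simp
    · cases s <;> simp only [FullShape] at h1
      rw [List.map_cons, List.nodup_cons, List.mem_map]
      refine ⟨?_, h1.2.nodup⟩
      rintro ⟨q, hq, rfl⟩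
      exact lt_irrefl _ (h1.1 q hq)
  have hall : ∀ i, ∃ q ∈ l, q.2 = i := fun i => by
    have : i ∈ (Set.univ : Set (Fin n)) := trivial
    rwa [← h5] at this
  refine ⟨l.map Prod.fst, mem_codeLanguage_iff.2 ⟨?_, h3, h2⟩, l, rfl, hnd, hall, h1⟩
  have hsub : (Finset.univ : Finset (Fin n)) ⊆ (l.map Prod.snd).toFinset := fun i _ => by
    obtain ⟨q, hq, rfl⟩ := hall i
    simpa using ⟨q.1, hq⟩
  have := (Finset.card_le_card hsub).trans (List.toFinset_card_le _)
  simp at this ⊢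
  omega

theorem exists_encoding {n : ℕ} {π : Equiv.Perm (Fin n)} (h : IsSimpleInA π)
    (h' : SecondNeOne π) : ∃ w ∈ codeLanguage, Encodes w π := by
  obtain ⟨w, hw, hl⟩ := exists_labelling h h'
  exact ⟨w, hw, (encodes_iff (cons_mem_codeLanguage hw)).2 hl⟩

theorem Encodes.word_unique {n : ℕ} {w w' : List Letter} {π : Equiv.Perm (Fin n)}
    (hw : w ∈ codeLanguage) (hw' : w' ∈ codeLanguage) (h : Encodes w π) (h' : Encodes w' π) :
    w = w' := by
  obtain ⟨l, hl⟩ := (encodes_iff (cons_mem_codeLanguage hw)).1 h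
  obtain ⟨l', hl'⟩ := (encodes_iff (cons_mem_codeLanguage hw')).1 h'
  have hlen := hl.length_eq
  have hlen' := hl'.length_eq
  have hu := (points_eq_univ hl).trans (points_eq_univ hl').symm
  obtain ⟨h4, -, hadm⟩ := mem_codeLanguage_iff.1 hw
  obtain ⟨h4', -, hadm'⟩ := mem_codeLanguage_iff.1 hw'
  obtain ⟨rfl, -, -, hf⟩ := hl
  obtain ⟨rfl, -, -, hf'⟩ := hl'
  rw [hf.unique hf' hadm hadm' (by omega) (by omega) hu]

theorem exists_equiv : ∃ enc : HalfSimples ≃ {w : List Letter // w ∈ codeLanguage},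
    ∀ p : HalfSimples, Encodes (enc p).1 p.1.2 := by
  choose f hf hf' using fun p : HalfSimples => exists_encoding p.2.1 p.2.2
  refine ⟨Equiv.ofBijective (fun p => ⟨f p, hf p⟩) ⟨?_, ?_⟩, hf'⟩
  · intro p q hpq
    have h1 := hf' p
    have h2 := hf' q
    simp only [Subtype.mk.injEq] at hpq
    rw [← hpq] at h2
    obtain ⟨⟨n, π⟩, hp⟩ := p
    obtain ⟨⟨m, π'⟩, hq⟩ := q
    have hnm : n = m := h1.length_eq.symm.trans h2.length_eq
    subst hnm
    have : π = π' := h1.perm_unique h2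
    subst this
    rfl
  · rintro ⟨w, hw⟩
    obtain ⟨π, hπ⟩ := exists_encodes (cons_mem_codeLanguage hw)
    have hp := hπ.isSimpleInA hw
    exact ⟨⟨⟨w.length, π⟩, hp⟩, Subtype.ext ((hf' ⟨⟨w.length, π⟩, hp⟩).word_unique (hf _) hw hπ)⟩

/-! ### Generating functions of the permutations -/

theorem letterCount_eq_weight (w : List Letter) :
    letterCount w = weight (fun s => Finsupp.single s 1) w := by
  induction w with
  | nil => simp [letterCount, weight]
  | cons s w ih =>
    have h1 : weight (fun s => Finsupp.single s 1) (s :: w) =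
        Finsupp.single s 1 + weight (fun s => Finsupp.single s 1) w := by simp [weight]
    rw [h1, ← ih, letterCount, letterCount, ← Multiset.cons_coe, ← Multiset.singleton_add, map_add,
      Multiset.toFinsupp_singleton]

theorem languageGF_eq : languageGF = wordGF (fun s => Finsupp.single s 1) codeLanguage := by
  funext m
  simp only [languageGF, wordGF, letterCount_eq_weight]
  rfl

theorem languageGF_mul : languageGF * refinedDenominator = refinedNumerator := by
  rw [languageGF_eq]
  exact wordGF_codeLanguage (by simp) (x := MvPowerSeries.X) fun s => rfl

theorem refinedGF_eq (enc : HalfSimples ≃ {w : List Letter // w ∈ codeLanguage}) :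
    refinedGF enc = languageGF := by
  funext m
  simp only [refinedGF, languageGF]
  congr 1
  exact Nat.card_congr ((enc.subtypeEquiv (q := fun w => letterCount w.1 = m) fun _ => Iff.rfl).trans
    (Equiv.subtypeSubtypeEquivSubtypeInter (fun w => w ∈ codeLanguage)
      fun w => letterCount w = m))

theorem card_half_eq (n : ℕ) : Nat.card {π : Equiv.Perm (Fin n) // IsSimpleInA π ∧ SecondNeOne π} =
    Nat.card {w : List Letter // w ∈ codeLanguage ∧ w.length = n} := by
  choose f hf hf' using fun p : {π : Equiv.Perm (Fin n) // IsSimpleInA π ∧ SecondNeOne π} =>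
    exists_encoding p.2.1 p.2.2
  refine Nat.card_congr (Equiv.ofBijective (fun p => ⟨f p, hf p, (hf' p).length_eq⟩) ⟨?_, ?_⟩)
  · intro p q hpq
    have h2 := hf' q
    simp only [Subtype.mk.injEq] at hpq
    rw [← hpq] at h2
    exact Subtype.ext ((hf' p).perm_unique h2)
  · rintro ⟨w, hw, rfl⟩
    obtain ⟨π, hπ⟩ := exists_encodes (cons_mem_codeLanguage hw)
    have hp := hπ.isSimpleInA hw
    exact ⟨⟨π, hp⟩, Subtype.ext ((hf' ⟨π, hp⟩).word_unique (hf _) hw hπ)⟩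

theorem halfGF_eq : halfGF = wordGF (fun _ => Finsupp.single () 1) codeLanguage := by
  ext n
  rw [halfGF, PowerSeries.coeff_mk, card_half_eq]
  change _ = (({w | w ∈ codeLanguage ∧
    weight (fun _ => Finsupp.single () 1) w = Finsupp.single () n}.ncard : ℕ) : ℤ)
  have hw (w : List Letter) : weight (fun _ => Finsupp.single () 1) w =
      Finsupp.single () w.length := by
    simp [weight]
  simp only [hw]
  have : ∀ w : List Letter, Finsupp.single () w.length = Finsupp.single () n ↔ w.length = n :=
    fun w => (Finsupp.single_injective ()).eq_iff
  simp only [this]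
  rfl

/-- With all letters equal to `X`, the denominator `1 - X - 5X² - 3X³` factors as `(1 - 3X)(1 +
X)²`, and one factor `1 + X` cancels against the numerator. -/
theorem halfGF_mul :
    halfGF * ((1 - 3 * PowerSeries.X) * (1 + PowerSeries.X)) = PowerSeries.X ^ 4 := by
  have h := wordGF_codeLanguage (wt := fun _ => Finsupp.single () 1) (by simp)
    (x := fun _ => (PowerSeries.X : PowerSeries ℤ)) fun s => rfl
  rw [← halfGF_eq] at h
  have hne : (1 + PowerSeries.X : PowerSeries ℤ) ≠ 0 := by
    intro h0
    have := congrArg PowerSeries.constantCoeff h0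
    simp at this
  refine mul_right_cancel₀ hne ?_
  refine Eq.trans ?_ h
  ring

/-! ### Inversion and the factor two -/

theorem inClassA_inv {n : ℕ} {π : Equiv.Perm (Fin n)} (h : InClassA π) : InClassA π⁻¹ := by
  rw [inClassA_iff] at h ⊢
  have h' := h.swap
  constructor
  · intro p _ q _ r _ s _
    simpa using h'.h4231 (π⁻¹ p) trivial (π⁻¹ q) trivial (π⁻¹ r) trivial (π⁻¹ s) trivial
  · intro p _ q _ r _ s _ t _
    simpa using h'.h35142 (π⁻¹ p) trivial (π⁻¹ q) trivial (π⁻¹ r) trivial (π⁻¹ s) trivial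
      (π⁻¹ t) trivial
  · intro p _ q _ r _ s _ t _
    simpa using h'.h42513 (π⁻¹ p) trivial (π⁻¹ q) trivial (π⁻¹ r) trivial (π⁻¹ s) trivial
      (π⁻¹ t) trivial
  · intro p _ q _ r _ s _ t _ u _
    simpa using h'.h351624 (π⁻¹ p) trivial (π⁻¹ q) trivial (π⁻¹ r) trivial (π⁻¹ s) trivial
      (π⁻¹ t) trivial (π⁻¹ u) trivial

theorem isSimple_inv {n : ℕ} {π : Equiv.Perm (Fin n)} (h : IsSimple π) : IsSimple π⁻¹ := by
  intro I h1 h2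
  have him : π '' ((π⁻¹ : Equiv.Perm (Fin n)) '' I) = I := by
    rw [← Set.image_comp]
    simp
  rcases h ((π⁻¹ : Equiv.Perm (Fin n)) '' I) h2 (by rwa [him]) with h3 | h3
  · left
    rw [← him]
    exact h3.image π
  · right
    rw [← him, h3]
    simp

theorem isSimpleInA_inv {n : ℕ} {π : Equiv.Perm (Fin n)} (h : IsSimpleInA π) : IsSimpleInA π⁻¹ :=
  ⟨h.1, isSimple_inv h.2.1, inClassA_inv h.2.2⟩

/-- Exactly one of `π(2) = 1` and `π(1) = 2` holds. If `π(2) ≠ 1`, the code begins with `dd`, so the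
second `d` is the only point below the leftmost one and `π(1) = 2`. Both equations together would
make the first two points an interval. -/
theorem secondNeOne_inv {n : ℕ} {π : Equiv.Perm (Fin n)} (h : IsSimpleInA π) :
    SecondNeOne π⁻¹ ↔ ¬ SecondNeOne π := by
  have h4 := h.1
  constructor
  · intro h1 h2
    obtain ⟨w, hw, l, hl⟩ := exists_labelling h h2
    obtain ⟨h5, hdd, hadm⟩ := mem_codeLanguage_iff.1 hw
    have hu := points_eq_univ hl
    obtain ⟨rfl, -, -, hfull⟩ := hl
    rcases l with _ | ⟨⟨s, p⟩, _ | ⟨⟨t, q⟩, l⟩⟩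
    · simp at hdd
    · simp at hdd
    simp only [List.map_cons, List.cons_prefix_cons, List.nil_prefix, and_true] at hdd
    obtain ⟨rfl, rfl⟩ := hdd
    obtain ⟨hp, hs⟩ := hfull
    simp only [Shape, List.mem_cons, forall_eq_or_imp] at hp hs
    have hmem (i : Fin n) : i = p ∨ i = q ∨ ∃ z ∈ l, z.2 = i := by
      have : i ∈ (Set.univ : Set (Fin n)) := trivial
      rwa [← hu, points_cons, points_cons] at this
    have hp0 : (p : ℕ) = 0 := by
      rcases hmem ⟨0, by omega⟩ with h0 | h0 | ⟨z, hz, h0⟩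
      · simp [← h0]
      · have := hp.1
        rw [← h0] at this
        simp [Fin.lt_def] at this
      · have := hp.2 z hz
        rw [h0] at this
        simp [Fin.lt_def] at this
    have hp1 : (π p : ℕ) = 1 := by
      have hqp := hs.1
      have hq0 : (π q : ℕ) = 0 := by
        rcases hmem (π⁻¹ ⟨0, by omega⟩) with h0 | h0 | ⟨z, hz, h0⟩
        · rw [← h0] at hqp
          simp [Fin.lt_def] at hqp
        · rw [← h0]
          simp
        · have := hqp.trans (hs.2.1 z hz)
          rw [h0] at this
          simp [Fin.lt_def] at this
      rw [Fin.lt_def, hq0] at hqp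
      rcases hmem (π⁻¹ ⟨1, by omega⟩) with h0 | h0 | ⟨z, hz, h0⟩
      · rw [← h0]
        simp
      · rw [← h0] at hq0
        simp at hq0
      · have := hs.2.1 z hz
        rw [h0] at this
        simp [Fin.lt_def] at this
        omega
    exact h1 (π p) hp1 (by simpa using hp0)
  · intro h1 i hi h0
    simp only [SecondNeOne, not_forall, not_not] at h1
    obtain ⟨j, hj, hj0⟩ := h1
    have hs := (isSimple_iff π).1 h.2.1
    have hij : π⁻¹ i ≠ j := by
      intro hij
      rw [← hij] at hj
      omega
    have hpi : (π (π⁻¹ i) : ℕ) = 1 := by simpa using hi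
    have hint : Interval (fun i => i) (fun i => π i) Set.univ {π⁻¹ i, j} := by
      refine ⟨Set.subset_univ _, fun p hp q hq r _ => ?_⟩
      have hq' : (q : ℕ) ≤ 1 ∧ (π q : ℕ) ≤ 1 := by
        rcases hq with rfl | rfl <;> omega
      constructor <;> intro h6 h7 <;> simp only [Fin.lt_def] at h6 h7 <;> omega
    rcases hs _ hint with h2 | h2
    · exact hij (h2 (.inl rfl) (.inr rfl))
    · have h3 : (Finset.univ : Finset (Fin n)) = {π⁻¹ i, j} :=
        Finset.coe_injective (by rw [Finset.coe_univ, ← h2]; simp)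
      have h5 := Finset.card_le_two (a := π⁻¹ i) (b := j)
      rw [← h3, Finset.card_univ, Fintype.card_fin] at h5
      omega

theorem simpleGF_eq : simpleGF = 2 * halfGF := by
  ext n
  rw [two_mul, map_add, simpleGF, halfGF, PowerSeries.coeff_mk, PowerSeries.coeff_mk,
    ← Nat.cast_add]
  congr 1
  have h1 : Nat.card {π : Equiv.Perm (Fin n) // IsSimpleInA π} =
      Nat.card {π : Equiv.Perm (Fin n) // IsSimpleInA π ∧ SecondNeOne π} +
      Nat.card {π : Equiv.Perm (Fin n) // IsSimpleInA π ∧ ¬ SecondNeOne π} := by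
    have hc (p : Equiv.Perm (Fin n) → Prop) : Nat.card {π // p π} = {π | p π}.ncard :=
      Nat.card_coe_set_eq {π | p π}
    rw [hc, hc, hc, ← Set.ncard_union_eq _ (Set.toFinite _) (Set.toFinite _)]
    · congr 1
      ext π
      simp only [Set.mem_union, Set.mem_ofPred_eq]
      tauto
    · rw [Set.disjoint_left]
      exact fun π h h' => h'.2 h.2
  rw [h1]
  congr 1
  refine Nat.card_congr ((Equiv.inv _).subtypeEquiv fun π => ?_)
  simp only [Equiv.inv_apply]
  constructor
  · exact fun h => ⟨isSimpleInA_inv h.1, (secondNeOne_inv h.1).2 h.2⟩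
  · intro h
    have := isSimpleInA_inv h.1
    rw [inv_inv] at this
    exact ⟨this, (secondNeOne_inv this).1 h.2⟩

end HullPerm

/-- The language of codes is regular, its words correspond bijectively to the simple permutations of
`Av(4231, 35142, 42513, 351624)` with `π(2) ≠ 1` through the explicit encoding, and the generating
functions are the stated fractions. Each fraction is written as a product with its denominator,
which is a unit because its constant coefficient is `1`. -/
theorem mainTheorem3 :
    HullPerm.codeLanguage.IsRegular ∧
    (∃ enc : HullPerm.HalfSimples ≃ {w : List HullPerm.Letter // w ∈ HullPerm.codeLanguage},
      (∀ p : HullPerm.HalfSimples, HullPerm.Encodes (enc p).1 p.1.2) ∧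
      (∀ p : HullPerm.HalfSimples, (enc p).1.length = p.1.1) ∧
      HullPerm.refinedGF enc * HullPerm.refinedDenominator = HullPerm.refinedNumerator) ∧
    HullPerm.languageGF * HullPerm.refinedDenominator = HullPerm.refinedNumerator ∧
    HullPerm.halfGF * ((1 - 3 * PowerSeries.X) * (1 + PowerSeries.X)) = PowerSeries.X ^ 4 ∧
    HullPerm.simpleGF = 2 * HullPerm.halfGF ∧
    HullPerm.simpleGF * ((1 - 3 * PowerSeries.X) * (1 + PowerSeries.X)) =
      2 * PowerSeries.X ^ 4 := by
  obtain ⟨enc, henc⟩ := HullPerm.exists_equiv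
  open HullPerm in
  exact ⟨isRegular_codeLanguage,
    ⟨enc, henc, fun p => (henc p).length_eq, by rw [refinedGF_eq, languageGF_mul]⟩,
    languageGF_mul, halfGF_mul, simpleGF_eq, by rw [simpleGF_eq, mul_assoc, halfGF_mul]⟩
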